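/- **Theorem (semantic correctness of forward-mode AD at first-order types).** *Language.* Types are $\tau ::= \mathbf{real} \mid \tau_1 * \cdots * \tau_n \mid \tau\to\tau' \mid \{\ell_1\,\tau_1 \mid\cdots\mid \ell_n\,\tau_n\} \mid \mathbf{list}(\tau)$ with $n \ge 0$. Typed terms $\Gamma\vdash t:\tau$ are built from variables, real constants $\underline c$, $t+s$, $t*s$, $\varsigma(t)$, further operations $\mathsf{op}(t_1,\dots,t_n)$ from a given family of operations $\mathbf{real}^n\to\mathbf{real}$, tuples and pattern matching on tuples, $\lambda$-abstraction and application, injections into and case distinction on variants, $[\,]$, $t::s$ and $\mathbf{fold}\,(x_1,x_2).t\ \mathbf{over}\ s\ \mathbf{from}\ r$. Each $\mathsf{op}$ is interpreted by a smooth function $\mathbb R^n\to\mathbb R$ and comes with chosen terms $x_1,\dots,x_n:\mathbf{real}\vdash\partial_i\mathsf{op}:\mathbf{real}$ $(1\le i\le n)$ whose interpretation is the $i$-th partial derivative of the interpretation of $\mathsf{op}$. *Semantics.* Types and contexts are interpreted as diffeological spaces: $[\![\mathbf{real}]\!]=\mathbb R$, products (and contexts) by product spaces, $\tau\to\tau'$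 by the space of smooth maps with the functional diffeology, variants by disjoint unions, $[\![\mathbf{list}(\tau)]\!]=\biguplus_{k\ge 0}[\![\tau]\!]^k$. Terms $\Gamma\vdash t:\tau$ are interpreted in the usual way as smooth maps $[\![t]\!]:[\![\Gamma]\!]\to[\![\tau]\!]$, with $\varsigma(x)=1/(1+e^{-x})$ and $\mathbf{fold}$ as the right fold. *Macro.* $\mathcal D(\mathbf{real})=\mathbf{real}*\mathbf{real}$, and $\mathcal D$ commutes with the other type constructors and is applied to the types of all variables of a context. On terms, $\mathcal D(x)=x$, $\mathcal D(\underline c)=\langle\underline c,\underline 0\rangle$; with $\mathcal D(t)$ matched as $\langle x,x'\rangle$, $\mathcal D(s)$ as $\langle y,y'\rangle$ and $\mathcal D(t_i)$ as $\langle x_i,x_i'\rangle$, $$\mathcal D(t+s)=\langle x+y,\,x'+y'\rangle,\quad \mathcal D(t*s)=\langle x*y,\,x*y'+x'*y\rangle,\quad \mathcal D(\varsigma(t))=\mathbf{let}\ z=\varsigma(x)\ \mathbf{in}\ \langle z,\,x'*z*(1-z)\rangle,$$ $$\mathcal D(\mathsf{op}(t_1,\dots,t_n))=\Big\langle \mathsf{op}(x_1,\dots,x_n),\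 \sum_{i=1}^n x_i'*\partial_i\mathsf{op}(x_1,\dots,x_n)\Big\rangle;$$ $\mathcal D$ commutes with all other term constructors. Thus $\mathcal D\Gamma\vdash\mathcal D t:\mathcal D\tau$ whenever $\Gamma\vdash t:\tau$. *Manifolds.* A manifold is a diffeological space that is Hausdorff and second countable in its D-topology and in which every point lies in an open subset diffeomorphic to some $\mathbb R^k$ (with $k$ depending on the point). The tangent bundle $TM$ of a manifold $M$ consists of the pairs $(x,[\gamma])$ with $\gamma:\mathbb R\to M$ smooth and $\gamma(0)=x$, where $\gamma\sim\delta$ iff $\gamma(0)=\delta(0)$ and $(f\circ\gamma)'(0)=(f\circ\delta)'(0)$ for all smooth $f:M\to\mathbb R$; it is a manifold with charts $(x,v)\mapsto[t\mapsto\psi(x+tv)]$ for the charts $\psi:\mathbb R^k\to M$. For smooth $f:M\to N$, $Tf(x,[\gamma])=(f(x),[f\circ\gamma])$. *Canonical maps.* For a first-order type $\tau$ (one without function types) define $\phi_\tau:[\![\mathcal D\tau]\!]\to T[\![\tau]\!]$ by induction: $\phi_{\mathbf{real}}(x,x')=(x,[t\mapsto x+x't])$; at products by the canonical map $TM_1\times\cdots\times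 TM_n\to T(M_1\times\cdots\times M_n)$, $([\gamma_i])_i\mapsto[t\mapsto(\gamma_i(t))_i]$; at variants and lists by the canonical maps $\biguplus_i TM_i\to T(\biguplus_i M_i)$ induced by the inclusions, combined with the previous one for the powers $[\![\tau]\!]^k$. For a first-order context $\Gamma$ (all of whose variables have first-order types), $\phi_\Gamma:[\![\mathcal D\Gamma]\!]\to T[\![\Gamma]\!]$ is defined as for products. *Claim.* Let $\tau$ be a first-order type, $\Gamma$ a first-order context and $\Gamma\vdash t:\tau$ any term (which may use higher-order subterms). Then $[\![\Gamma]\!]$ and $[\![\tau]\!]$ are manifolds, $\phi_\Gamma:[\![\mathcal D\Gamma]\!]\to T[\![\Gamma]\!]$ and $\phi_\tau:[\![\mathcal D\tau]\!]\to T[\![\tau]\!]$ are diffeomorphisms, and $$\phi_\tau\circ[\![\mathcal D t]\!] = T[\![t]\!]\circ\phi_\Gamma .$$ -/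

import Mathlib

open scoped ContDiff Topology
open Diffeology

noncomputable section

namespace AD

universe u

/-! ### Diffeological spaces

Mathlib's diffeologies are given by plots on the whole spaces `ℝⁿ`. As `ℝⁿ` is connected, a plot of
a disjoint union factors through one summand. -/

/-- The model space `ℝⁿ`. -/
abbrev E (n : ℕ) : Type := EuclideanSpace ℝ (Fin n)

/-- Product diffeology of two spaces. -/
instance instProd {X Y : Type*} [DiffeologicalSpace X] [DiffeologicalSpace Y] :
    DiffeologicalSpace (X × Y) where
  plots _ := {p | IsPlot (fun u => (p u).1) ∧ IsPlot (fun u => (p u).2)}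
  constant_plots _ := ⟨isPlot_const, isPlot_const⟩
  plot_reparam hp hf := ⟨isPlot_reparam hp.1 hf, isPlot_reparam hp.2 hf⟩
  locality hp := by
    constructor
    · refine DiffeologicalSpace.locality fun x => ?_
      obtain ⟨v, hv, hx, h⟩ := hp x
      exact ⟨v, hv, hx, fun hf hs => (h hf hs).1⟩
    · refine DiffeologicalSpace.locality fun x => ?_
      obtain ⟨v, hv, hx, h⟩ := hp x
      exact ⟨v, hv, hx, fun hf hs => (h hf hs).2⟩

/-- Product diffeology of a family. -/
instance instPi {ι : Type*} {X : ι → Type*} [∀ i, DiffeologicalSpace (X i)] :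
    DiffeologicalSpace (∀ i, X i) where
  plots _ := {p | ∀ i, IsPlot (fun u => p u i)}
  constant_plots _ := fun _ => isPlot_const
  plot_reparam hp hf := fun i => isPlot_reparam (hp i) hf
  locality hp := fun i => by
    refine DiffeologicalSpace.locality fun x => ?_
    obtain ⟨v, hv, hx, h⟩ := hp x
    exact ⟨v, hv, hx, fun hf hs => h hf hs i⟩

/-- The smooth maps `X → Y`. -/
def DMap (X Y : Type*) [DiffeologicalSpace X] [DiffeologicalSpace Y] : Type _ :=
  {f : X → Y // DSmooth f}

instance instDMapCoe {X Y : Type*} [DiffeologicalSpace X] [DiffeologicalSpace Y] :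
    CoeFun (DMap X Y) (fun _ => X → Y) := ⟨fun f => f.1⟩

/-- Composition of smooth maps. -/
def DMap.comp {X Y Z : Type*} [DiffeologicalSpace X] [DiffeologicalSpace Y] [DiffeologicalSpace Z]
    (g : DMap Y Z) (f : DMap X Y) : DMap X Z := ⟨fun x => g (f x), g.2.comp f.2⟩

/-- Functional diffeology: `p` is a plot iff `(u, x) ↦ p u x` is smooth. -/
instance instDMap {X Y : Type*} [DiffeologicalSpace X] [DiffeologicalSpace Y] :
    DiffeologicalSpace (DMap X Y) where
  plots n := {p | DSmooth (fun z : E n × X => p z.1 z.2)}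
  constant_plots f := fun _ _ hp => f.2 _ _ hp.2
  plot_reparam {n m p f} hp hf := fun k q hq =>
    hp k (fun u => (f (q u).1, (q u).2)) ⟨(hf.comp hq.1.contDiff).isPlot, hq.2⟩
  locality {n p} hp := fun k q hq => by
    refine DiffeologicalSpace.locality fun x => ?_
    obtain ⟨v, hv, hx, h⟩ := hp (q x).1
    refine ⟨(fun u => (q u).1) ⁻¹' v, hv.preimage hq.1.contDiff.continuous, hx, ?_⟩
    intro m f hf hs
    exact h (f := fun w => (q (f w)).1) hf (hq.1.contDiff.comp hs) m
      (fun w => (w, (q (f w)).2)) ⟨isPlot_id, isPlot_reparam hq.2 hs⟩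

/-- Disjoint union: the plots are the plots of the summands. -/
instance instSigma {ι : Type*} {X : ι → Type*} [∀ i, DiffeologicalSpace (X i)] :
    DiffeologicalSpace (Σ i, X i) where
  plots n := {p | ∃ (i : ι) (q : E n → X i), IsPlot q ∧ p = fun u => ⟨i, q u⟩}
  constant_plots x := ⟨x.1, fun _ => x.2, isPlot_const, rfl⟩
  plot_reparam {n m p f} hp hf := by
    obtain ⟨i, q, hq, rfl⟩ := hp
    exact ⟨i, q ∘ f, isPlot_reparam hq hf, rfl⟩
  locality {n p} hp := by
    have hloc : IsLocallyConstant (fun u => (p u).1) := by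
      rw [IsLocallyConstant.iff_exists_open]
      intro x
      obtain ⟨v, hv, hx, h⟩ := hp x
      obtain ⟨ε, hε, hb⟩ := Metric.isOpen_iff.mp hv x hx
      have ht := OpenPartialHomeomorph.univBall_target x hε
      have hs := OpenPartialHomeomorph.univBall_source (E := E n) x ε
      obtain ⟨i, q, -, he⟩ := h (f := OpenPartialHomeomorph.univBall x ε)
        (fun y => hb (ht ▸ (OpenPartialHomeomorph.univBall x ε).map_source (hs ▸ Set.mem_univ y)))
        OpenPartialHomeomorph.contDiff_univBall
      have key : ∀ y ∈ Metric.ball x ε, (p y).1 = i := by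
        intro y hy
        have h1 := (OpenPartialHomeomorph.univBall x ε).right_inv (ht ▸ hy)
        have h2 := congrFun he ((OpenPartialHomeomorph.univBall x ε).symm y)
        simp only [Function.comp_apply, h1] at h2
        rw [h2]
      exact ⟨_, Metric.isOpen_ball, Metric.mem_ball_self hε, fun y hy =>
        (key y hy).trans (key x (Metric.mem_ball_self hε)).symm⟩
    have hc : ∀ u, ∃ a : X (p 0).1, p u = ⟨(p 0).1, a⟩ := by
      intro u
      have h0 : (p u).1 = (p 0).1 := hloc.apply_eq_of_preconnectedSpace u 0
      exact ⟨h0 ▸ (p u).2, Sigma.ext h0 (by simp)⟩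
    choose q hq using hc
    refine ⟨_, q, DiffeologicalSpace.locality fun x => ?_, funext hq⟩
    obtain ⟨v, hv, hx, h⟩ := hp x
    refine ⟨v, hv, hx, fun {m f} hf hs => ?_⟩
    obtain ⟨j, q', hq', he⟩ := h hf hs
    have hj : (p 0).1 = j := by
      have := congrFun he 0
      rw [Function.comp_apply, hq (f 0)] at this
      exact congrArg Sigma.fst this
    subst hj
    have : q ∘ f = q' := by
      funext y
      have := congrFun he y
      rw [Function.comp_apply, hq (f y)] at this
      exact eq_of_heq (Sigma.mk.inj this).2
    rw [this]
    exact hq'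

/-- Lists: the diffeology of the disjoint union of the powers `Xᵏ`, for `k = 0, 1, 2, …`. -/
instance instList {X : Type*} [DiffeologicalSpace X] : DiffeologicalSpace (List X) where
  plots n := {p | IsPlot (fun u : E n => List.equivSigmaTuple (p u))}
  constant_plots x := by
    change IsPlot (fun _ => List.equivSigmaTuple x)
    exact isPlot_const
  plot_reparam {n m p f} hp hf := by
    change IsPlot (fun u => List.equivSigmaTuple (p u)) at hp
    exact isPlot_reparam hp hf
  locality {n p} hp := by
    change IsPlot (fun u => List.equivSigmaTuple (p u))
    exact DiffeologicalSpace.locality hp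

instance instUnit : DiffeologicalSpace Unit where
  plots _ := Set.univ
  constant_plots _ := trivial
  plot_reparam _ _ := trivial
  locality _ := trivial

theorem isPlot_list_iff {X : Type*} [DiffeologicalSpace X] {n : ℕ} {p : E n → List X} :
    IsPlot p ↔ ∃ (k : ℕ) (q : E n → Fin k → X),
      (∀ i, IsPlot (fun u => q u i)) ∧ p = fun u => List.ofFn (q u) := by
  change IsPlot (fun u => List.equivSigmaTuple (p u)) ↔ _
  constructor
  · rintro ⟨k, q, hq, he⟩
    refine ⟨k, q, hq, funext fun u => ?_⟩
    have := congrArg List.equivSigmaTuple.symm (congrFun he u)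
    simpa using this
  · rintro ⟨k, q, hq, rfl⟩
    exact ⟨k, q, hq, funext fun u => List.equivSigmaTuple.apply_symm_apply ⟨k, q u⟩⟩

/-- The inclusion of a summand. -/
def injMap {ι : Type*} {X : ι → Type*} [∀ i, DiffeologicalSpace (X i)] (i : ι) :
    DMap (X i) (Σ i, X i) := ⟨fun a => ⟨i, a⟩, fun _ p hp => ⟨i, p, hp, rfl⟩⟩

/-- The inclusion of the lists of length `k`. -/
def listMap {X : Type*} [DiffeologicalSpace X] (k : ℕ) : DMap (Fin k → X) (List X) :=
  ⟨List.ofFn, fun _ p hp => isPlot_list_iff.2 ⟨k, p, hp, rfl⟩⟩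

/-- `f` is an isomorphism of diffeological spaces. -/
def IsDiffeo {X Y : Type*} [DiffeologicalSpace X] [DiffeologicalSpace Y] (f : X → Y) : Prop :=
  DSmooth f ∧ ∃ g : Y → X, DSmooth g ∧ Function.LeftInverse g f ∧ Function.RightInverse g f

/-! ### Manifolds and tangent bundles -/

/-- `ψ : ℝᵏ → X` is the inverse of a chart: a diffeomorphism of `ℝᵏ` onto an open subset. -/
def IsChart {X : Type*} [DiffeologicalSpace X] {k : ℕ} (ψ : E k → X) : Prop :=
  IsPlot ψ ∧ Function.Injective ψ ∧ IsOpen[dTopology] (Set.range ψ) ∧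
    ∀ (n : ℕ) (q : E n → E k), IsPlot (ψ ∘ q) → ContDiff ℝ ∞ q

/-- Smooth manifolds, as a full subcategory of the diffeological spaces: Hausdorff, second countable
and covered by charts, whose dimensions may vary. -/
def IsSmoothManifold (X : Type*) [DiffeologicalSpace X] : Prop :=
  @T2Space X dTopology ∧ @SecondCountableTopology X dTopology ∧
    ∀ x : X, ∃ (k : ℕ) (ψ : E k → X), IsChart ψ ∧ x ∈ Set.range ψ

/-- Two smooth curves are tangent at `0`: they have the same base point `γ 0`, and
`(f ∘ γ)' (0) = (f ∘ δ)' (0)` for all smooth `f : X → ℝ`. -/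
def tangentSetoid (X : Type*) [DiffeologicalSpace X] : Setoid (DMap ℝ X) where
  r γ δ := γ 0 = δ 0 ∧
    ∀ f : DMap X ℝ, deriv (fun t => f (γ t)) 0 = deriv (fun t => f (δ t)) 0
  iseqv :=
    { refl := fun _ => ⟨rfl, fun _ => rfl⟩
      symm := fun h => ⟨h.1.symm, fun f => (h.2 f).symm⟩
      trans := fun h h' => ⟨h.1.trans h'.1, fun f => (h.2 f).trans (h'.2 f)⟩ }

/-- The tangent bundle, the disjoint union over `x` of the classes of curves with `γ 0 = x`. -/
def Tangent (X : Type*) [DiffeologicalSpace X] : Type _ := Quotient (tangentSetoid X)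

section Tangent

variable {X Y : Type*} [DiffeologicalSpace X] [DiffeologicalSpace Y]

/-- The tangent vector `(γ 0, [γ])`. -/
def Tangent.mk (γ : DMap ℝ X) : Tangent X := Quotient.mk (tangentSetoid X) γ

/-- The derivative of a smooth map, `(x, [γ]) ↦ (f x, [f ∘ γ])`. -/
def Tangent.map (f : DMap X Y) : Tangent X → Tangent Y :=
  Quotient.map' (s₁ := tangentSetoid X) (s₂ := tangentSetoid Y) (fun γ => f.comp γ)
    (fun _ _ h => ⟨congrArg f.1 h.1, fun g => h.2 (g.comp f)⟩)

/-- The straight line `t ↦ ψ (x + t v)` in a chart. -/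
def chartLine {k : ℕ} (ψ : E k → X) (hψ : IsPlot ψ) (x v : E k) : DMap ℝ X :=
  ⟨fun t => ψ (x + t • v), hψ.dSmooth.comp' (ContDiff.dSmooth (by fun_prop))⟩

/-- The structure of a manifold on the tangent bundle: its charts are the maps
`(x, v) ↦ [t ↦ ψ (x + t v)]` for the charts `ψ` of `X`. -/
instance instTangent (X : Type*) [DiffeologicalSpace X] : DiffeologicalSpace (Tangent X) :=
  DiffeologicalSpace.generateFrom
    {p | ∃ (k : ℕ) (ψ : E k → X) (hψ : IsChart ψ) (x v : E p.1 → E k),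
      ContDiff ℝ ∞ x ∧ ContDiff ℝ ∞ v ∧
        p.2 = fun w => Tangent.mk (chartLine ψ hψ.1 (x w) (v w))}

/-- The smooth curve `t ↦ (γ t, δ t)`. -/
def pairCurve (γ : DMap ℝ X) (δ : DMap ℝ Y) : DMap ℝ (X × Y) :=
  ⟨fun t => (γ t, δ t), fun _ p hp => ⟨γ.2 _ p hp, δ.2 _ p hp⟩⟩

theorem deriv_pair (γ : DMap ℝ X) (δ : DMap ℝ Y) (f : DMap (X × Y) ℝ) :
    deriv (fun t => f (γ t, δ t)) 0
      = deriv (fun t => f (γ t, δ 0)) 0 + deriv (fun t => f (γ 0, δ t)) 0 := by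
  have hF : ContDiff ℝ ∞ (fun z : E 2 => f (γ (z 0), δ (z 1))) := by
    refine IsPlot.contDiff (f.2 2 (fun z => (γ (z 0), δ (z 1))) ⟨?_, ?_⟩)
    · exact γ.2 _ _ (ContDiff.isPlot (by fun_prop))
    · exact δ.2 _ _ (ContDiff.isPlot (by fun_prop))
  set F := fun z : E 2 => f (γ (z 0), δ (z 1))
  have hd : HasFDerivAt F (fderiv ℝ F 0) 0 :=
    (hF.differentiable (by simp) 0).hasFDerivAt
  have key : ∀ a : E 2, deriv (fun t : ℝ => F (t • a)) 0 = fderiv ℝ F 0 a := by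
    intro a
    have h1 : HasDerivAt (fun t : ℝ => t • a) a 0 := by
      simpa using (hasDerivAt_id (0 : ℝ)).smul_const a
    have h2 : HasFDerivAt F (fderiv ℝ F 0) ((0 : ℝ) • a) := by simpa using hd
    exact (h2.comp_hasDerivAt (0 : ℝ) h1).deriv
  have e := map_add (fderiv ℝ F 0) !₂[1, 0] !₂[0, 1]
  rw [← key, ← key, ← key] at e
  simpa [F] using e

theorem pairCurve_rel {γ γ' : DMap ℝ X} {δ δ' : DMap ℝ Y} (h : (tangentSetoid X).r γ γ')
    (h' : (tangentSetoid Y).r δ δ') :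
    (tangentSetoid (X × Y)).r (pairCurve γ δ) (pairCurve γ' δ') := by
  refine ⟨Prod.ext h.1 h'.1, fun f => ?_⟩
  change deriv (fun t => f (γ t, δ t)) 0 = deriv (fun t => f (γ' t, δ' t)) 0
  rw [deriv_pair, deriv_pair, ← h.1, ← h'.1]
  congr 1
  · exact h.2 ⟨fun x => f (x, δ 0), fun _ p hp => f.2 _ (fun w => (p w, δ 0)) ⟨hp, isPlot_const⟩⟩
  · exact h'.2 ⟨fun y => f (γ 0, y), fun _ p hp => f.2 _ (fun w => (γ 0, p w)) ⟨isPlot_const, hp⟩⟩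

/-- The canonical map `TX × TY → T(X × Y)`, `([γ], [δ]) ↦ [t ↦ (γ t, δ t)]`. -/
def Tangent.pair : Tangent X → Tangent Y → Tangent (X × Y) :=
  Quotient.map₂ (sa := tangentSetoid X) (sb := tangentSetoid Y) (sc := tangentSetoid (X × Y))
    pairCurve (fun _ _ h _ _ h' => pairCurve_rel h h')

/-- The smooth curve `t ↦ (γ₁ t, …, γₙ t)`. -/
def tupleCurve {n : ℕ} {X : Fin n → Type*} [∀ i, DiffeologicalSpace (X i)]
    (γ : ∀ i, DMap ℝ (X i)) : DMap ℝ (∀ i, X i) :=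
  ⟨fun t i => γ i t, fun _ p hp i => (γ i).2 _ p hp⟩

/-- The smooth map `(x, y) ↦ (x, y₁, …, yₙ)`. -/
def consMap {n : ℕ} (X : Fin (n + 1) → Type*) [∀ i, DiffeologicalSpace (X i)] :
    DMap (X 0 × ∀ i : Fin n, X i.succ) (∀ i, X i) :=
  ⟨fun z => Fin.cons z.1 z.2, fun _ _ hp i => by
    refine Fin.cases ?_ (fun j => ?_) i
    · exact hp.1
    · exact hp.2 j⟩

/-- The canonical map `TX₁ × ⋯ × TXₙ → T(X₁ × ⋯ × Xₙ)`,
`([γ₁], …, [γₙ]) ↦ [t ↦ (γ₁ t, …, γₙ t)]`, in terms of representatives;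
by `Tangent.tuple_mk` their choice does not matter. -/
def Tangent.tuple {n : ℕ} {X : Fin n → Type*} [∀ i, DiffeologicalSpace (X i)]
    (v : ∀ i, Tangent (X i)) : Tangent (∀ i, X i) :=
  Tangent.mk (tupleCurve fun i => Quotient.out (v i))

theorem tupleCurve_rel : ∀ {n : ℕ} {X : Fin n → Type*} [∀ i, DiffeologicalSpace (X i)]
    {γ δ : ∀ i, DMap ℝ (X i)}, (∀ i, (tangentSetoid (X i)).r (γ i) (δ i)) →
    (tangentSetoid (∀ i, X i)).r (tupleCurve γ) (tupleCurve δ)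
  | 0, X, _, γ, δ, _ => by
    have : tupleCurve γ = tupleCurve δ := Subtype.ext (funext fun t => funext fun i => i.elim0)
    exact this ▸ ⟨rfl, fun _ => rfl⟩
  | n + 1, X, _, γ, δ, h => by
    have e : ∀ γ : ∀ i, DMap ℝ (X i), tupleCurve γ =
        (consMap X).comp (pairCurve (γ 0) (tupleCurve fun i : Fin n => γ i.succ)) := by
      intro γ
      refine Subtype.ext (funext fun t => funext fun i => ?_)
      refine Fin.cases ?_ (fun j => ?_) i
      · rfl
      · rfl
    have r := pairCurve_rel (h 0) (tupleCurve_rel fun i : Fin n => h i.succ)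
    rw [e γ, e δ]
    exact ⟨congrArg (consMap X).1 r.1, fun g => r.2 (g.comp (consMap X))⟩

theorem Tangent.tuple_mk {n : ℕ} {X : Fin n → Type*} [∀ i, DiffeologicalSpace (X i)]
    (γ : ∀ i, DMap ℝ (X i)) :
    Tangent.tuple (fun i => Tangent.mk (γ i)) = Tangent.mk (tupleCurve γ) :=
  Quotient.sound (s := tangentSetoid (∀ i, X i)) (tupleCurve_rel fun i =>
    Quotient.exact (s := tangentSetoid (X i)) (Quotient.out_eq _))

end Tangent

/-! ### The language -/

/-- Types: reals, `n`-ary products, functions, variants with `n` constructors, lists.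
The constructors of a variant are named by their positions. -/
inductive Ty : Type
  | real : Ty
  | prod (n : ℕ) (σ : Fin n → Ty) : Ty
  | fn (σ τ : Ty) : Ty
  | variant (n : ℕ) (σ : Fin n → Ty) : Ty
  | list (τ : Ty) : Ty

/-- First order types: those without function types. -/
def Ty.FirstOrder : Ty → Prop
  | .real => True
  | .prod _ σ => ∀ i, (σ i).FirstOrder
  | .fn _ _ => False
  | .variant _ σ => ∀ i, (σ i).FirstOrder
  | .list τ => τ.FirstOrder

/-- Contexts, built up by one typed variable or by a block of `n` typed variables at a time. -/
inductive Ctx : Type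
  | nil : Ctx
  | snoc (Γ : Ctx) (τ : Ty) : Ctx
  | block (Γ : Ctx) (n : ℕ) (σ : Fin n → Ty) : Ctx

/-- First order contexts: all variables have first order types. -/
def Ctx.FirstOrder : Ctx → Prop
  | .nil => True
  | .snoc Γ τ => Γ.FirstOrder ∧ τ.FirstOrder
  | .block Γ _ σ => Γ.FirstOrder ∧ ∀ i, (σ i).FirstOrder

/-- `Var Γ τ`: the variables of type `τ` in `Γ`. -/
inductive Var : Ctx → Ty → Type
  | last {Γ : Ctx} {τ : Ty} : Var (Γ.snoc τ) τ
  | skip {Γ : Ctx} {σ τ : Ty} (x : Var Γ τ) : Var (Γ.snoc σ) τ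
  | inBlock {Γ : Ctx} {n : ℕ} {σ : Fin n → Ty} (i : Fin n) : Var (Γ.block n σ) (σ i)
  | skipBlock {Γ : Ctx} {n : ℕ} {σ : Fin n → Ty} {τ : Ty} (x : Var Γ τ) : Var (Γ.block n σ) τ

/-- A family of basic operations `ℝⁿ → ℝ`, interpreted by smooth functions; they come in addition
to the constants, `+`, `*` and the sigmoid function. -/
structure Ops where
  Op : ℕ → Type u
  interp : ∀ {n : ℕ}, Op n → (Fin n → ℝ) → ℝ
  smooth : ∀ {n : ℕ} (o : Op n), ContDiff ℝ ∞ (interp o)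

/-- `Term O Γ τ`: the well-typed terms `Γ ⊢ t : τ`. -/
inductive Term (O : Ops.{u}) : Ctx → Ty → Type u
  | var {Γ : Ctx} {τ : Ty} (x : Var Γ τ) : Term O Γ τ
  | const {Γ : Ctx} (c : ℝ) : Term O Γ .real
  | add {Γ : Ctx} (t s : Term O Γ .real) : Term O Γ .real
  | mul {Γ : Ctx} (t s : Term O Γ .real) : Term O Γ .real
  | sigmoid {Γ : Ctx} (t : Term O Γ .real) : Term O Γ .real
  | op {Γ : Ctx} {n : ℕ} (o : O.Op n) (t : Fin n → Term O Γ .real) : Term O Γ .real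
  /-- `⟨t₁, …, tₙ⟩` -/
  | tuple {Γ : Ctx} {n : ℕ} {σ : Fin n → Ty} (t : ∀ i, Term O Γ (σ i)) : Term O Γ (.prod n σ)
  /-- `case t of ⟨x₁, …, xₙ⟩ → s` -/
  | split {Γ : Ctx} {n : ℕ} {σ : Fin n → Ty} {τ : Ty} (t : Term O Γ (.prod n σ))
      (s : Term O (Γ.block n σ) τ) : Term O Γ τ
  | lam {Γ : Ctx} {σ τ : Ty} (t : Term O (Γ.snoc σ) τ) : Term O Γ (.fn σ τ)
  | app {Γ : Ctx} {σ τ : Ty} (t : Term O Γ (.fn σ τ)) (s : Term O Γ σ) : Term O Γ τ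
  | inj {Γ : Ctx} {n : ℕ} {σ : Fin n → Ty} (i : Fin n) (t : Term O Γ (σ i)) :
      Term O Γ (.variant n σ)
  /-- `case t of {ℓ₁ x₁ → s₁ | ⋯ | ℓₙ xₙ → sₙ}` -/
  | cases {Γ : Ctx} {n : ℕ} {σ : Fin n → Ty} {τ : Ty} (t : Term O Γ (.variant n σ))
      (s : ∀ i, Term O (Γ.snoc (σ i)) τ) : Term O Γ τ
  | nil {Γ : Ctx} {τ : Ty} : Term O Γ (.list τ)
  | cons {Γ : Ctx} {τ : Ty} (t : Term O Γ τ) (s : Term O Γ (.list τ)) : Term O Γ (.list τ)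
  /-- `fold (x₁, x₂). t over s from r` -/
  | fold {Γ : Ctx} {σ τ : Ty} (t : Term O ((Γ.snoc τ).snoc σ) σ) (s : Term O Γ (.list τ))
      (r : Term O Γ σ) : Term O Γ σ

/-- Renamings of variables. -/
def Ren (Γ Δ : Ctx) : Type := ∀ τ : Ty, Var Γ τ → Var Δ τ

/-- A renaming under one bound variable. -/
def Ren.snoc {Γ Δ : Ctx} (r : Ren Γ Δ) (σ : Ty) : Ren (Γ.snoc σ) (Δ.snoc σ)
  | _, .last => .last
  | _, .skip x => .skip (r _ x)

/-- A renaming under a block of bound variables. -/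
def Ren.block {Γ Δ : Ctx} (r : Ren Γ Δ) (n : ℕ) (σ : Fin n → Ty) :
    Ren (Γ.block n σ) (Δ.block n σ)
  | _, .inBlock i => .inBlock i
  | _, .skipBlock x => .skipBlock (r _ x)

/-- The action of renamings on terms. -/
def Term.rename {O : Ops.{u}} {Γ : Ctx} {τ : Ty} (t : Term O Γ τ) {Δ : Ctx} (r : Ren Γ Δ) :
    Term O Δ τ :=
  match t with
  | .var x => .var (r _ x)
  | .const c => .const c
  | .add t s => .add (t.rename r) (s.rename r)
  | .mul t s => .mul (t.rename r) (s.rename r)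
  | .sigmoid t => .sigmoid (t.rename r)
  | .op o t => .op o (fun i => (t i).rename r)
  | .tuple t => .tuple (fun i => (t i).rename r)
  | .split t s => .split (t.rename r) (s.rename (r.block _ _))
  | .lam t => .lam (t.rename (r.snoc _))
  | .app t s => .app (t.rename r) (s.rename r)
  | .inj i t => .inj i (t.rename r)
  | .cases t s => .cases (t.rename r) (fun i => (s i).rename (r.snoc _))
  | .nil => .nil
  | .cons t s => .cons (t.rename r) (s.rename r)
  | .fold t s u => .fold (t.rename ((r.snoc _).snoc _)) (s.rename r) (u.rename r)

/-- `let x = t in s`, i.e. `(λ x. s) t`. -/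
def Term.letIn {O : Ops.{u}} {Γ : Ctx} {σ τ : Ty} (t : Term O Γ σ) (s : Term O (Γ.snoc σ) τ) :
    Term O Γ τ := .app (.lam s) t

/-- `t - s`, i.e. `t + (-1) * s`. -/
def Term.sub {O : Ops.{u}} {Γ : Ctx} (t s : Term O Γ .real) : Term O Γ .real :=
  .add t (.mul (.const (-1)) s)

/-- `t₁ + ⋯ + tₙ`. -/
def Term.sum {O : Ops.{u}} {Γ : Ctx} : ∀ {n : ℕ}, (Fin n → Term O Γ .real) → Term O Γ .real
  | 0, _ => .const 0
  | _ + 1, t => .add (t 0) (Term.sum fun i => t i.succ)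

/-! ### Semantics -/

/-- Bundled diffeological spaces. -/
structure DSp where
  carrier : Type
  str : DiffeologicalSpace carrier

instance instDSp (X : DSp) : DiffeologicalSpace X.carrier := X.str

/-- The interpretation of types as diffeological spaces. -/
def Ty.sp : Ty → DSp
  | .real => ⟨ℝ, inferInstance⟩
  | .prod _ σ => ⟨∀ i, (σ i).sp.carrier, inferInstance⟩
  | .fn σ τ => ⟨DMap σ.sp.carrier τ.sp.carrier, inferInstance⟩
  | .variant _ σ => ⟨Σ i, (σ i).sp.carrier, inferInstance⟩
  | .list τ => ⟨List τ.sp.carrier, inferInstance⟩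

/-- The interpretation of contexts as products. -/
def Ctx.sp : Ctx → DSp
  | .nil => ⟨Unit, inferInstance⟩
  | .snoc Γ τ => ⟨Γ.sp.carrier × τ.sp.carrier, inferInstance⟩
  | .block Γ _ σ => ⟨Γ.sp.carrier × ∀ i, (σ i).sp.carrier, inferInstance⟩

/-- The set underlying the interpretation of a type. -/
abbrev Ty.sem (τ : Ty) : Type := τ.sp.carrier

/-- The set underlying the interpretation of a context. -/
abbrev Ctx.sem (Γ : Ctx) : Type := Γ.sp.carrier

section Combinators

variable {X Y Z : Type*} [DiffeologicalSpace X] [DiffeologicalSpace Y] [DiffeologicalSpace Z]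

/-- Pairing. -/
def DMap.pair (f : DMap X Y) (g : DMap X Z) : DMap X (Y × Z) :=
  ⟨fun x => (f x, g x), fun _ p hp => ⟨f.2 _ p hp, g.2 _ p hp⟩⟩

/-- Tupling. -/
def DMap.tuple {ι : Type*} {Y : ι → Type*} [∀ i, DiffeologicalSpace (Y i)]
    (f : ∀ i, DMap X (Y i)) : DMap X (∀ i, Y i) :=
  ⟨fun x i => f i x, fun _ p hp i => (f i).2 _ p hp⟩

/-- Currying. -/
def DMap.curry (f : DMap (X × Y) Z) : DMap X (DMap Y Z) :=
  ⟨fun x => ⟨fun y => f (x, y), fun _ p hp => f.2 _ (fun w => (x, p w)) ⟨isPlot_const, hp⟩⟩,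
    fun _ p hp _ q hq => f.2 _ (fun w => (p (q w).1, (q w).2))
      ⟨isPlot_reparam hp hq.1.contDiff, hq.2⟩⟩

/-- Application. -/
def DMap.ap (f : DMap X (DMap Y Z)) (g : DMap X Y) : DMap X Z :=
  ⟨fun x => f x (g x), fun n p hp =>
    f.2 _ p hp n (fun w => (w, g (p w))) ⟨isPlot_id, g.2 _ p hp⟩⟩

/-- Case distinction. -/
def DMap.cases {ι : Type*} {Y : ι → Type*} [∀ i, DiffeologicalSpace (Y i)]
    (f : DMap X (Σ i, Y i)) (g : ∀ i, DMap (X × Y i) Z) : DMap X Z :=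
  ⟨fun x => g (f x).1 (x, (f x).2), fun n p hp => by
    obtain ⟨i, q, hq, he⟩ := f.2 _ p hp
    have : (fun x => g (f x).1 (x, (f x).2)) ∘ p = fun w => g i (p w, q w) := by
      funext w
      have h : f (p w) = ⟨i, q w⟩ := congrFun he w
      simp only [Function.comp_apply]
      rw [h]
    rw [this]
    exact (g i).2 _ (fun w => (p w, q w)) ⟨hp, hq⟩⟩

/-- Adding an element to a list. -/
def DMap.cons (f : DMap X Y) (g : DMap X (List Y)) : DMap X (List Y) :=
  ⟨fun x => f x :: g x, fun n p hp => by
    obtain ⟨k, q, hq, he⟩ := isPlot_list_iff.1 (g.2 _ p hp)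
    refine isPlot_list_iff.2 ⟨k + 1, fun w => Fin.cons (f (p w)) (q w), fun i => ?_, ?_⟩
    · refine Fin.cases ?_ (fun j => ?_) i
      · exact f.2 _ p hp
      · exact hq j
    · funext w
      have h : g (p w) = List.ofFn (q w) := congrFun he w
      simp [h, List.ofFn_succ]⟩

/-- Folding over a list, from the right. -/
def DMap.fold (f : DMap ((X × Y) × Z) Z) (g : DMap X (List Y)) (h : DMap X Z) : DMap X Z :=
  ⟨fun x => (g x).foldr (fun a b => f ((x, a), b)) (h x), fun n p hp => by
    obtain ⟨k, q, hq, he⟩ := isPlot_list_iff.1 (g.2 _ p hp)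
    have key : ∀ (k : ℕ) (q : E n → Fin k → Y), (∀ i, IsPlot (fun w => q w i)) →
        IsPlot (fun w => (List.ofFn (q w)).foldr (fun a b => f ((p w, a), b)) (h (p w))) := by
      intro k
      induction k with
      | zero => intro q _; exact h.2 _ p hp
      | succ k ih =>
        intro q hq
        simp only [List.ofFn_succ, List.foldr_cons]
        exact f.2 _ (fun w => ((p w, q w 0), _))
          ⟨⟨hp, hq 0⟩, ih (fun w i => q w i.succ) (fun i => hq i.succ)⟩
    have e : (fun x => (g x).foldr (fun a b => f ((x, a), b)) (h x)) ∘ p =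
        fun w => (List.ofFn (q w)).foldr (fun a b => f ((p w, a), b)) (h (p w)) := by
      funext w
      have h' : g (p w) = List.ofFn (q w) := congrFun he w
      simp only [Function.comp_apply]
      rw [h']
    rw [e]
    exact key k q hq⟩

/-- Smooth functions of several real variables, for the product diffeology. -/
def DMap.ofContDiff {n : ℕ} (f : (Fin n → ℝ) → ℝ) (hf : ContDiff ℝ ∞ f) : DMap (Fin n → ℝ) ℝ :=
  ⟨f, fun _ _ hp => (hf.comp (contDiff_pi.2 fun i => (hp i).contDiff)).isPlot⟩

/-- Addition. -/
def DMap.add (f g : DMap X ℝ) : DMap X ℝ :=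
  ⟨fun x => f x + g x, fun _ p hp => ((f.2 _ p hp).contDiff.add (g.2 _ p hp).contDiff).isPlot⟩

/-- Multiplication. -/
def DMap.mul (f g : DMap X ℝ) : DMap X ℝ :=
  ⟨fun x => f x * g x, fun _ p hp => ((f.2 _ p hp).contDiff.mul (g.2 _ p hp).contDiff).isPlot⟩

/-- The sigmoid function `x ↦ 1 / (1 + exp (-x))`. -/
def DMap.sigmoid (f : DMap X ℝ) : DMap X ℝ :=
  ⟨fun x => Real.sigmoid (f x), fun _ p hp =>
    ((contDiff_sigmoid.of_le le_top).comp (f.2 _ p hp).contDiff).isPlot⟩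

/-- Constant maps. -/
def DMap.const (y : Y) : DMap X Y := ⟨fun _ => y, dSmooth_const⟩

end Combinators

/-- The interpretation of variables as projections. -/
def Var.sem {Γ : Ctx} {τ : Ty} (x : Var Γ τ) : DMap Γ.sem τ.sem :=
  match x with
  | .last => ⟨fun ρ => ρ.2, fun _ _ hp => hp.2⟩
  | .skip x => ⟨fun ρ => x.sem ρ.1, fun _ p hp => x.sem.2 _ (fun w => (p w).1) hp.1⟩
  | .inBlock (σ := _) i => ⟨fun ρ => ρ.2 i, fun _ _ hp => hp.2 i⟩
  | .skipBlock x => ⟨fun ρ => x.sem ρ.1, fun _ p hp => x.sem.2 _ (fun w => (p w).1) hp.1⟩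

/-- The interpretation of terms as smooth maps. -/
def Term.sem {O : Ops.{u}} : ∀ {Γ : Ctx} {τ : Ty}, Term O Γ τ → DMap Γ.sem τ.sem
  | _, _, .var x => x.sem
  | _, _, .const c => DMap.const (Y := ℝ) c
  | _, _, .add t s => DMap.add t.sem s.sem
  | _, _, .mul t s => DMap.mul t.sem s.sem
  | _, _, .sigmoid t => DMap.sigmoid t.sem
  | _, _, .op o t => (DMap.ofContDiff (O.interp o) (O.smooth o)).comp (DMap.tuple fun i => (t i).sem)
  | _, _, .tuple t => DMap.tuple fun i => (t i).sem
  | _, _, .split t s => s.sem.comp (DMap.pair ⟨fun ρ => ρ, dSmooth_id⟩ t.sem)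
  | _, _, .lam t => t.sem.curry
  | _, _, .app t s => t.sem.ap s.sem
  | _, _, .inj i t => (injMap i).comp t.sem
  | _, _, .cases t s => t.sem.cases fun i => (s i).sem
  | _, _, .nil (τ := τ) => DMap.const (Y := List τ.sem) []
  | _, _, .cons t s => t.sem.cons s.sem
  | _, _, .fold t s r => t.sem.fold s.sem r.sem

/-! ### Forward mode automatic differentiation -/

/-- The macro on types. -/
def Ty.D : Ty → Ty
  | .real => .prod 2 (fun _ => .real)
  | .prod n σ => .prod n (fun i => (σ i).D)
  | .fn σ τ => .fn σ.D τ.D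
  | .variant n σ => .variant n (fun i => (σ i).D)
  | .list τ => .list τ.D

/-- The macro on contexts. -/
def Ctx.D : Ctx → Ctx
  | .nil => .nil
  | .snoc Γ τ => .snoc Γ.D τ.D
  | .block Γ n σ => .block Γ.D n (fun i => (σ i).D)

/-- The macro on variables. -/
def Var.D {Γ : Ctx} {τ : Ty} (x : Var Γ τ) : Var Γ.D τ.D :=
  match x with
  | .last => .last
  | .skip x => .skip x.D
  | .inBlock (σ := σ) i => .inBlock (σ := fun i => (σ i).D) i
  | .skipBlock x => .skipBlock x.D

/-- The context `x₁ : real, …, xₙ : real`. -/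
abbrev realCtx (n : ℕ) : Ctx := Ctx.nil.block n (fun _ => .real)

/-- A choice of terms `x₁, …, xₙ : real ⊢ ∂ᵢ op : real` for the basic operations. -/
abbrev Partials (O : Ops.{u}) : Type u :=
  ∀ (n : ℕ), O.Op n → Fin n → Term O (realCtx n) .real

/-- The chosen terms denote the partial derivatives of the operations. -/
def Partials.Correct {O : Ops.{u}} (pd : Partials O) : Prop :=
  ∀ (n : ℕ) (o : O.Op n) (i : Fin n) (x : Fin n → ℝ),
    (pd n o i).sem ((), x) = deriv (fun s : ℝ => O.interp o (Function.update x i s)) (x i)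

/-- `Γ, x₁ : real, x₁' : real, …, xₖ : real, xₖ' : real`. -/
def pairsCtx (Γ : Ctx) : ℕ → Ctx
  | 0 => Γ
  | k + 1 => (pairsCtx Γ k).block 2 (fun _ => .real)

/-- The variables `xᵢ` (for `j = 0`) and `xᵢ'` (for `j = 1`) of `pairsCtx Γ k`. -/
def pairsVar {Γ : Ctx} : ∀ {k : ℕ}, Fin k → Fin 2 → Var (pairsCtx Γ k) .real
  | 0, i, _ => i.elim0
  | k + 1, i, j => Fin.lastCases (motive := fun _ => Var (pairsCtx Γ (k + 1)) .real)
      (.inBlock (σ := fun _ => .real) j) (fun i' => .skipBlock (pairsVar i' j)) i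

/-- Weakening from `Γ` to `pairsCtx Γ k`. -/
def pairsWk {Γ : Ctx} : ∀ k : ℕ, Ren Γ (pairsCtx Γ k)
  | 0, _, x => x
  | k + 1, _, x => .skipBlock (pairsWk k _ x)

/-- `case t₁ of ⟨x₁, x₁'⟩ → ⋯ → case tₖ of ⟨xₖ, xₖ'⟩ → s`. -/
def splitPairs {O : Ops.{u}} {Γ : Ctx} {τ : Ty} : ∀ {k : ℕ},
    (Fin k → Term O Γ (.prod 2 (fun _ => .real))) → Term O (pairsCtx Γ k) τ → Term O Γ τ
  | 0, _, s => s
  | k + 1, t, s => splitPairs (fun i => t i.castSucc)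
      (.split ((t (Fin.last k)).rename (pairsWk k)) s)

/-- The renaming of the variables of `realCtx n` to the variables `xᵢ` of `pairsCtx Γ n`. -/
def pairsRen {Γ : Ctx} {n : ℕ} : Ren (realCtx n) (pairsCtx Γ n)
  | _, .inBlock i => pairsVar i 0

/-- `⟨t, s⟩ : real * real`. -/
def Term.dual {O : Ops.{u}} {Γ : Ctx} (t s : Term O Γ .real) :
    Term O Γ (.prod 2 (fun _ => .real)) :=
  .tuple ![t, s]

/-- The macro on terms. -/
def Term.D {O : Ops.{u}} (pd : Partials O) {Γ : Ctx} {τ : Ty} (t : Term O Γ τ) : Term O Γ.D τ.D :=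
  match t with
  | .var x => .var x.D
  | .const c => .dual (.const c) (.const 0)
  | .add t s => splitPairs ![t.D pd, s.D pd]
      (let x := .var (pairsVar 0 0)
       let x' := .var (pairsVar 0 1)
       let y := .var (pairsVar 1 0)
       let y' := .var (pairsVar 1 1)
       .dual (.add x y) (.add x' y'))
  | .mul t s => splitPairs ![t.D pd, s.D pd]
      (let x := .var (pairsVar 0 0)
       let x' := .var (pairsVar 0 1)
       let y := .var (pairsVar 1 0)
       let y' := .var (pairsVar 1 1)
       .dual (.mul x y) (.add (.mul x y') (.mul x' y)))
  | .sigmoid t => splitPairs ![t.D pd]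
      (.letIn (.sigmoid (.var (pairsVar 0 0)))
        (let x' := .var (.skip (pairsVar 0 1))
         let y := .var .last
         .dual y (.mul (.mul x' y) (.sub (.const 1) y))))
  | .op o t => splitPairs (fun i => (t i).D pd)
      (.dual (.op o (fun i => .var (pairsVar i 0)))
        (.sum fun i => .mul (.var (pairsVar i 1)) ((pd _ o i).rename pairsRen)))
  | .tuple t => .tuple (fun i => (t i).D pd)
  | .split t s => .split (t.D pd) (s.D pd)
  | .lam t => .lam (t.D pd)
  | .app t s => .app (t.D pd) (s.D pd)
  | .inj (σ := σ) i t => .inj (σ := fun i => (σ i).D) i (t.D pd)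
  | .cases t s => .cases (t.D pd) (fun i => (s i).D pd)
  | .nil => .nil
  | .cons t s => .cons (t.D pd) (s.D pd)
  | .fold t s r => .fold (t.D pd) (s.D pd) (r.D pd)

/-! ### The canonical isomorphisms -/

/-- The line `t ↦ x + x' t` in `ℝ`. -/
def realLine (x x' : ℝ) : DMap ℝ ℝ :=
  ⟨fun t => x + x' * t, ContDiff.dSmooth (by fun_prop)⟩

/-- The canonical isomorphism `⟦D τ⟧ ≅ T⟦τ⟧` at a first order type `τ`. -/
def Ty.toTangent : ∀ τ : Ty, τ.FirstOrder → τ.D.sem → Tangent τ.sem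
  | .real, _, a => Tangent.mk (realLine (a 0) (a 1))
  | .prod _ σ, h, a => Tangent.tuple fun i => (σ i).toTangent (h i) (a i)
  | .fn _ _, h, _ => h.elim
  | .variant _ σ, h, a => Tangent.map (injMap a.1) ((σ a.1).toTangent (h a.1) a.2)
  | .list τ, h, a =>
    Tangent.map (listMap (List.length a)) (Tangent.tuple fun i => τ.toTangent h (List.get a i))

/-- The canonical isomorphism `⟦D Γ⟧ ≅ T⟦Γ⟧` at a first order context `Γ`. -/
def Ctx.toTangent : ∀ Γ : Ctx, Γ.FirstOrder → Γ.D.sem → Tangent Γ.sem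
  | .nil, _, _ => Tangent.mk (DMap.const (Y := Unit) ())
  | .snoc Γ τ, h, a => Tangent.pair (Γ.toTangent h.1 a.1) (τ.toTangent h.2 a.2)
  | .block Γ _ σ, h, a =>
    Tangent.pair (Γ.toTangent h.1 a.1) (Tangent.tuple fun i => (σ i).toTangent (h.2 i) (a.2 i))

end AD

end

open AD

/-!
Every first order type is a finite or countable combination of products and disjoint unions of `ℝ`,
hence a manifold. On a manifold `X` the map `γ ↦ [γ]` from curves to `TX` is smooth for the
functional diffeology, and smooth families of curves generate the diffeology of `TX`, so that
smoothness of maps out of `TX` can be tested on families of curves. Therefore `T` commutes with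
products and disjoint unions, and the canonical maps are diffeomorphisms by induction on types.

For the commuting square, call a curve `g` in `⟦D τ⟧` related to a curve `f` in `⟦τ⟧` if at
`τ = real` it is `(f, f')`, extended to all types as a logical relation. By the chain rule every
term preserves this relation. At first order types, `g 0` then represents the tangent vector `[f]`,
and every point of `⟦D Γ⟧` lies on a related curve.
-/

noncomputable section

namespace AD

universe u

/-! ### Smooth maps and diffeomorphisms -/

section Smooth

variable {V W : Type*} [NormedAddCommGroup V] [NormedSpace ℝ V] [DiffeologicalSpace V]
  [IsContDiffCompatible V] [NormedAddCommGroup W] [NormedSpace ℝ W] [DiffeologicalSpace W]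
  [IsContDiffCompatible W]

instance instIsContDiffCompatibleProd : IsContDiffCompatible (V × W) where
  isPlot_iff := ⟨fun h => h.1.contDiff.prodMk h.2.contDiff,
    fun h => ⟨h.fst.isPlot, h.snd.isPlot⟩⟩

theorem isOpen_preimage_of_dSmooth [FiniteDimensional ℝ V] {X : Type*} [DiffeologicalSpace X]
    {f : V → X} (hf : DSmooth f) {s : Set X} (hs : IsOpen[dTopology] s) : IsOpen (f ⁻¹' s) := by
  let e := toEuclidean (E := V)
  have he : IsPlot (f ∘ e.symm) := hf _ _ e.symm.contDiff.isPlot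
  rw [← e.symm.toHomeomorph.isOpen_preimage]
  exact isOpen_iff_preimages_plots.1 hs _ _ he

end Smooth

section Diffeo

variable {X Y Z : Type*} [DiffeologicalSpace X] [DiffeologicalSpace Y] [DiffeologicalSpace Z]

/-- The identity map. -/
def DMap.id : DMap X X := ⟨_root_.id, dSmooth_id⟩

/-- The first projection. -/
def DMap.fst : DMap (X × Y) X := ⟨Prod.fst, fun _ _ hp => hp.1⟩

/-- The second projection. -/
def DMap.snd : DMap (X × Y) Y := ⟨Prod.snd, fun _ _ hp => hp.2⟩

theorem dSmooth_swap : DSmooth (Prod.swap : X × Y → Y × X) := fun _ _ hp => ⟨hp.2, hp.1⟩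

theorem dSmooth_prodMap {X' Y' : Type*} [DiffeologicalSpace X'] [DiffeologicalSpace Y']
    {f : X → X'} {g : Y → Y'} (hf : DSmooth f) (hg : DSmooth g) : DSmooth (Prod.map f g) :=
  fun _ _ hp => ⟨hf _ _ hp.1, hg _ _ hp.2⟩

theorem IsDiffeo.comp {g : Y → Z} {f : X → Y} (hg : IsDiffeo g) (hf : IsDiffeo f) :
    IsDiffeo (g ∘ f) := by
  obtain ⟨hf, f', hf', lf, rf⟩ := hf
  obtain ⟨hg, g', hg', lg, rg⟩ := hg
  exact ⟨hg.comp hf, f' ∘ g', hf'.comp hg', lg.comp lf, rg.comp rf⟩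

theorem IsDiffeo.symm {e : X ≃ Y} (he : IsDiffeo e) : IsDiffeo e.symm := by
  obtain ⟨h, g, hg, hl, -⟩ := he
  have : g = e.symm := funext fun y => by rw [← hl (e.symm y), e.apply_symm_apply]
  exact ⟨this ▸ hg, e, h, e.right_inv, e.left_inv⟩

theorem IsDiffeo.prodMap {X' Y' : Type*} [DiffeologicalSpace X'] [DiffeologicalSpace Y']
    {f : X → X'} {g : Y → Y'} (hf : IsDiffeo f) (hg : IsDiffeo g) : IsDiffeo (Prod.map f g) := by
  obtain ⟨hf, f', hf', lf, rf⟩ := hf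
  obtain ⟨hg, g', hg', lg, rg⟩ := hg
  exact ⟨dSmooth_prodMap hf hg, Prod.map f' g', dSmooth_prodMap hf' hg', lf.prodMap lg,
    rf.prodMap rg⟩

theorem isDiffeo_of_unique [Unique X] [Unique Y] (f : X → Y) : IsDiffeo f :=
  ⟨Subsingleton.elim (fun _ => default) f ▸ dSmooth_const, default, dSmooth_const,
    fun _ => Subsingleton.elim _ _, fun _ => Subsingleton.elim _ _⟩

theorem isDiffeo_consEquiv {n : ℕ} (X : Fin (n + 1) → Type*) [∀ i, DiffeologicalSpace (X i)] :
    IsDiffeo (Fin.consEquiv X) :=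
  ⟨(consMap X).2, (Fin.consEquiv X).symm, fun _ _ hp => ⟨hp 0, fun i => hp i.succ⟩,
    (Fin.consEquiv X).left_inv, (Fin.consEquiv X).right_inv⟩

theorem isDiffeo_equivSigmaTuple : IsDiffeo (List.equivSigmaTuple (α := X)) := by
  refine ⟨fun _ _ hp => hp, List.equivSigmaTuple.symm, fun n p hp => ?_,
    List.equivSigmaTuple.left_inv, List.equivSigmaTuple.right_inv⟩
  change IsPlot fun u => List.equivSigmaTuple (List.equivSigmaTuple.symm (p u))
  simpa only [Equiv.apply_symm_apply] using hp

section Family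

variable {ι : Type*} {X Y : ι → Type*} [∀ i, DiffeologicalSpace (X i)]
  [∀ i, DiffeologicalSpace (Y i)] {f : ∀ i, X i → Y i}

theorem IsDiffeo.piMap (hf : ∀ i, IsDiffeo (f i)) : IsDiffeo (Pi.map f) := by
  choose hf g hg hl hr using hf
  exact ⟨fun _ _ hp i => hf i _ _ (hp i), Pi.map g, fun _ _ hp i => hg i _ _ (hp i),
    fun x => funext fun i => hl i (x i), fun y => funext fun i => hr i (y i)⟩

theorem dSmooth_sigmaMap (hf : ∀ i, DSmooth (f i)) : DSmooth (Sigma.map id f) := by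
  rintro n _ ⟨i, q, hq, rfl⟩
  exact ⟨i, f i ∘ q, hf i _ _ hq, rfl⟩

theorem IsDiffeo.sigmaMap (hf : ∀ i, IsDiffeo (f i)) : IsDiffeo (Sigma.map id f) := by
  choose hf g hg hl hr using hf
  exact ⟨dSmooth_sigmaMap hf, Sigma.map id g, dSmooth_sigmaMap hg,
    fun x => Sigma.ext rfl (heq_of_eq (hl _ _)), fun y => Sigma.ext rfl (heq_of_eq (hr _ _))⟩

theorem isPlot_sigmaMk_iff {i : ι} {n : ℕ} {q : E n → X i} :
    IsPlot (fun u => (⟨i, q u⟩ : Σ i, X i)) ↔ IsPlot q := by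
  refine ⟨?_, fun hq => ⟨i, q, hq, rfl⟩⟩
  rintro ⟨j, q', hq', he⟩
  obtain rfl : i = j := congrArg Sigma.fst (congrFun he 0)
  have : q = q' := funext fun u => eq_of_heq (Sigma.mk.inj (congrFun he u)).2
  exact this ▸ hq'

theorem exists_injMap_comp_eq {V : Type*} [NormedAddCommGroup V] [NormedSpace ℝ V]
    [FiniteDimensional ℝ V] [DiffeologicalSpace V] [IsContDiffCompatible V]
    (f : DMap V (Σ i, X i)) : ∃ (i : ι) (g : DMap V (X i)), (injMap i).comp g = f := by
  let e := toEuclidean (E := V)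
  obtain ⟨i, q, hq, hf⟩ := f.2 _ e.symm e.symm.contDiff.isPlot
  refine ⟨i, ⟨q ∘ e, hq.dSmooth.comp e.contDiff.dSmooth⟩, Subtype.ext (funext fun v => ?_)⟩
  simpa [injMap, DMap.comp] using (congrFun hf (e v)).symm

theorem exists_dMap_leftInverse_injMap {i : ι} (a : X i) :
    ∃ r : DMap (Σ i, X i) (X i), ∀ b, r (injMap i b) = b := by
  classical
  refine ⟨⟨fun z => if h : z.1 = i then h ▸ z.2 else a, ?_⟩, fun b => dif_pos rfl⟩
  rintro n _ ⟨j, q, hq, rfl⟩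
  by_cases h : j = i
  · subst h
    simpa [Function.comp_def] using hq
  · simpa [Function.comp_def, h] using isPlot_const

theorem dSmooth_indicator_sigma (s : Set ι) :
    DSmooth fun z : Σ i, X i => s.indicator (fun _ => (1 : ℝ)) z.1 := by
  rintro n _ ⟨i, q, -, rfl⟩
  exact isPlot_const (x := s.indicator (fun _ => (1 : ℝ)) i)

end Family

end Diffeo

/-! ### Manifolds -/

section Manifold

variable {X Y : Type*} [DiffeologicalSpace X] [DiffeologicalSpace Y]

namespace IsChart

variable {k : ℕ} {ψ : E k → X}

/- Precomposing with a diffeomorphism of the whole model space onto a ball turns `f` near a point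
into a global map with values in the range of `ψ`, to which the last clause of `IsChart` applies. -/
theorem contDiffOn {V : Type*} [NormedAddCommGroup V] [NormedSpace ℝ V] [FiniteDimensional ℝ V]
    [DiffeologicalSpace V] [IsContDiffCompatible V] (hψ : IsChart ψ) {f : V → X} (hf : DSmooth f)
    {q : V → E k} {s : Set V} (hs : IsOpen s) (hq : ∀ w ∈ s, ψ (q w) = f w) :
    ContDiffOn ℝ ∞ q s := by
  intro w hw
  let e := toEuclidean (E := V)
  obtain ⟨ε, hε, hb⟩ := Metric.isOpen_iff.1 (hs.preimage e.symm.continuous) (e w)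
    (by simpa using hw)
  let b := OpenPartialHomeomorph.univBall (e w) ε
  have hsource (u) : u ∈ b.source :=
    OpenPartialHomeomorph.univBall_source (e w) ε ▸ Set.mem_univ u
  have htarget : b.target = Metric.ball (e w) ε := OpenPartialHomeomorph.univBall_target (e w) hε
  have hplot : IsPlot (f ∘ e.symm ∘ b) :=
    hf _ _ (e.symm.contDiff.comp OpenPartialHomeomorph.contDiff_univBall).isPlot
  have hcomp : ψ ∘ q ∘ e.symm ∘ b = f ∘ e.symm ∘ b :=
    funext fun u => hq _ (hb (htarget ▸ b.map_source (hsource u)))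
  have hsmooth : ContDiff ℝ ∞ (q ∘ e.symm ∘ b) := hψ.2.2.2 _ _ (hcomp ▸ hplot)
  have hball : e ⁻¹' Metric.ball (e w) ε ∈ 𝓝 w :=
    e.continuous.continuousAt.preimage_mem_nhds (Metric.ball_mem_nhds _ hε)
  have hlocal : ContDiffAt ℝ ∞ ((q ∘ e.symm ∘ b) ∘ b.symm ∘ e) w :=
    hsmooth.contDiffAt.comp w ((OpenPartialHomeomorph.contDiffOn_univBall_symm.contDiffAt
      (Metric.ball_mem_nhds _ hε)).comp w e.contDiff.contDiffAt)
  refine (hlocal.congr_of_eventuallyEq ?_).contDiffWithinAt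
  filter_upwards [hball] with v hv
  simp [b.right_inv (htarget ▸ hv)]

theorem isOpen_image (hψ : IsChart ψ) {s : Set (E k)} (hs : IsOpen s) :
    IsOpen[dTopology] (ψ '' s) := by
  refine isOpen_iff_preimages_plots.2 fun n p hp => ?_
  have hU : IsOpen (p ⁻¹' Set.range ψ) := isOpen_iff_preimages_plots.1 hψ.2.2.1 n p hp
  have hq : ∀ w ∈ p ⁻¹' Set.range ψ, ψ (Function.invFun ψ (p w)) = p w :=
    fun w hw => Function.invFun_eq hw
  have : p ⁻¹' (ψ '' s) = p ⁻¹' Set.range ψ ∩ (fun w => Function.invFun ψ (p w)) ⁻¹' s := by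
    ext w
    refine ⟨?_, fun hw => ⟨_, hw.2, hq w hw.1⟩⟩
    rintro ⟨v, hv, hvw⟩
    refine ⟨⟨v, hvw⟩, ?_⟩
    rwa [Set.mem_preimage, ← hvw, Function.leftInverse_invFun hψ.2.1]
  rw [this]
  exact (hψ.contDiffOn hp.dSmooth hU hq).continuousOn.isOpen_inter_preimage hU hs

theorem secondCountableTopology_range (hψ : IsChart ψ) :
    letI : TopologicalSpace X := dTopology
    SecondCountableTopology (Set.range ψ) := by
  let _ : TopologicalSpace X := dTopology
  have hopen : IsOpenMap ψ := fun _ => hψ.isOpen_image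
  have hemb := Topology.IsOpenEmbedding.of_continuous_injective_isOpenMap
    hψ.1.continuous hψ.2.1 hopen
  exact hemb.isEmbedding.toHomeomorph.symm.secondCountableTopology

theorem comp_isDiffeo (hψ : IsChart ψ) {f : X → Y} (hf : IsDiffeo f) : IsChart (f ∘ ψ) := by
  obtain ⟨hf, g, hg, hl, hr⟩ := hf
  refine ⟨hf _ _ hψ.1, hl.injective.comp hψ.2.1, ?_, fun n q hq => hψ.2.2.2 n q ?_⟩
  · rw [Set.range_comp, Set.image_eq_preimage_of_inverse hl hr]
    exact isOpen_iff_preimages_plots.2 fun n p hp =>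
      isOpen_iff_preimages_plots.1 hψ.2.2.1 n _ (hg _ _ hp)
  · have := hg _ _ hq
    rwa [← Function.comp_assoc, ← Function.comp_assoc, hl.comp_eq_id, Function.id_comp] at this

theorem prodMap (hψ : IsChart ψ) {l n : ℕ} {χ : E l → Y} (hχ : IsChart χ)
    (e : E n ≃L[ℝ] E k × E l) : IsChart (Prod.map ψ χ ∘ e) := by
  refine ⟨⟨isPlot_reparam hψ.1 e.contDiff.fst, isPlot_reparam hχ.1 e.contDiff.snd⟩,
    (hψ.2.1.prodMap hχ.2.1).comp e.injective, ?_, fun m q hq => ?_⟩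
  · rw [e.surjective.range_comp, Set.range_prodMap]
    refine isOpen_iff_preimages_plots.2 fun n p hp => ?_
    exact (isOpen_iff_preimages_plots.1 hψ.2.2.1 n _ hp.1).inter
      (isOpen_iff_preimages_plots.1 hχ.2.2.1 n _ hp.2)
  · have heq : ContDiff ℝ ∞ (e ∘ q) := (hψ.2.2.2 m _ hq.1).prodMk (hχ.2.2.2 m _ hq.2)
    simpa [Function.comp_def] using e.symm.contDiff.comp heq

theorem sigmaMk {ι : Type*} {X : ι → Type*} [∀ i, DiffeologicalSpace (X i)] {i : ι}
    {ψ : E k → X i} (hψ : IsChart ψ) : IsChart (Sigma.mk i ∘ ψ) := by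
  refine ⟨(injMap i).2 _ _ hψ.1, sigma_mk_injective.comp hψ.2.1, ?_,
    fun n q hq => hψ.2.2.2 n q (isPlot_sigmaMk_iff.1 hq)⟩
  refine isOpen_iff_preimages_plots.2 ?_
  rintro n _ ⟨j, q, hq, rfl⟩
  rw [Set.range_comp]
  obtain rfl | hij := eq_or_ne i j
  · change IsOpen (q ⁻¹' (Sigma.mk i ⁻¹' (Sigma.mk i '' Set.range ψ)))
    rw [Set.preimage_image_eq _ sigma_mk_injective]
    exact isOpen_iff_preimages_plots.1 hψ.2.2.1 n q hq
  · change IsOpen (q ⁻¹' (Sigma.mk j ⁻¹' (Sigma.mk i '' Set.range ψ)))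
    rw [Set.preimage_image_sigmaMk_of_ne hij.symm]
    exact isOpen_empty

end IsChart

/-- `X` is covered by countably many charts; for Hausdorff spaces this is second countability plus
the existence of charts, and easier to transport along constructions. -/
def HasCountableAtlas (X : Type*) [DiffeologicalSpace X] : Prop :=
  ∃ S : Set (Σ k, E k → X), S.Countable ∧ (∀ ψ ∈ S, IsChart ψ.2) ∧
    ∀ x, ∃ ψ ∈ S, x ∈ Set.range ψ.2

theorem isSmoothManifold_iff :
    IsSmoothManifold X ↔ @T2Space X dTopology ∧ HasCountableAtlas X := by
  let _ : TopologicalSpace X := dTopology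
  constructor
  · rintro ⟨hT2, hcount, hcharts⟩
    choose k ψ hψ hmem using hcharts
    obtain ⟨t, ht, hcover⟩ := TopologicalSpace.countable_cover_nhds
      fun x => (hψ x).2.2.1.mem_nhds (hmem x)
    refine ⟨hT2, (fun x => ⟨k x, ψ x⟩) '' t, ht.image _, Set.forall_mem_image.2 fun x _ => hψ x,
      fun x => ?_⟩
    obtain ⟨y, hy, hx⟩ := Set.mem_iUnion₂.1 (hcover ▸ Set.mem_univ x)
    exact ⟨_, Set.mem_image_of_mem _ hy, hx⟩
  · rintro ⟨hT2, S, hS, hchart, hcover⟩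
    have := hS.to_subtype
    have (ψ : S) : SecondCountableTopology (Set.range ψ.1.2) :=
      (hchart ψ.1 ψ.2).secondCountableTopology_range
    refine ⟨hT2, TopologicalSpace.secondCountableTopology_of_countable_cover
      (U := fun ψ : S => Set.range ψ.1.2) (fun ψ => (hchart ψ.1 ψ.2).2.2.1) ?_, fun x => ?_⟩
    · refine Set.eq_univ_of_forall fun x => ?_
      obtain ⟨ψ, hψ, hx⟩ := hcover x
      exact Set.mem_iUnion.2 ⟨⟨ψ, hψ⟩, hx⟩
    · obtain ⟨ψ, hψ, hx⟩ := hcover x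
      exact ⟨ψ.1, ψ.2, hchart ψ hψ, hx⟩

namespace HasCountableAtlas

theorem of_isDiffeo (hX : HasCountableAtlas X) {f : X → Y} (hf : IsDiffeo f) :
    HasCountableAtlas Y := by
  obtain ⟨S, hS, hchart, hcover⟩ := hX
  refine ⟨(fun ψ => ⟨ψ.1, f ∘ ψ.2⟩) '' S, hS.image _,
    Set.forall_mem_image.2 fun ψ hψ => (hchart ψ hψ).comp_isDiffeo hf, fun y => ?_⟩
  obtain ⟨-, g, -, -, hr⟩ := hf
  obtain ⟨ψ, hψ, u, hu⟩ := hcover (g y)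
  exact ⟨_, Set.mem_image_of_mem _ hψ, u, (congrArg f hu).trans (hr y)⟩

theorem prod (hX : HasCountableAtlas X) (hY : HasCountableAtlas Y) :
    HasCountableAtlas (X × Y) := by
  obtain ⟨S, hS, hchart, hcover⟩ := hX
  obtain ⟨S', hS', hchart', hcover'⟩ := hY
  let e (k l : ℕ) : E (k + l) ≃L[ℝ] E k × E l := .ofFinrankEq (by simp)
  refine ⟨Set.image2 (fun ψ χ => ⟨ψ.1 + χ.1, Prod.map ψ.2 χ.2 ∘ e ψ.1 χ.1⟩) S S',
    hS.image2 hS' _, Set.forall_mem_image2.2 fun ψ hψ χ hχ =>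
      (hchart ψ hψ).prodMap (hchart' χ hχ) _, fun x => ?_⟩
  obtain ⟨ψ, hψ, hx⟩ := hcover x.1
  obtain ⟨χ, hχ, hx'⟩ := hcover' x.2
  refine ⟨_, Set.mem_image2_of_mem hψ hχ, ?_⟩
  rw [(e ψ.1 χ.1).surjective.range_comp, Set.range_prodMap]
  exact ⟨hx, hx'⟩

theorem sigma {ι : Type*} [Countable ι] {X : ι → Type*} [∀ i, DiffeologicalSpace (X i)]
    (hX : ∀ i, HasCountableAtlas (X i)) : HasCountableAtlas (Σ i, X i) := by
  choose S hS hchart hcover using hX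
  refine ⟨⋃ i, (fun ψ => ⟨ψ.1, Sigma.mk i ∘ ψ.2⟩) '' S i,
    Set.countable_iUnion fun i => (hS i).image _, ?_, ?_⟩
  · simp only [Set.mem_iUnion]
    rintro _ ⟨i, ψ, hψ, rfl⟩
    exact (hchart i ψ hψ).sigmaMk
  · rintro ⟨i, x⟩
    obtain ⟨ψ, hψ, u, rfl⟩ := hcover i x
    exact ⟨_, Set.mem_iUnion.2 ⟨i, Set.mem_image_of_mem _ hψ⟩, u, rfl⟩

end HasCountableAtlas

theorem exists_disjoint_isOpen_of_dSmooth {f : X → Y} (hf : DSmooth f)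
    (hY : @T2Space Y dTopology) {x y : X} (h : f x ≠ f y) :
    ∃ u v : Set X, IsOpen[dTopology] u ∧ IsOpen[dTopology] v ∧ x ∈ u ∧ y ∈ v ∧ Disjoint u v := by
  let _ : TopologicalSpace X := dTopology
  let _ : TopologicalSpace Y := dTopology
  exact separated_by_continuous hf.continuous h

namespace IsSmoothManifold

theorem of_isDiffeo (hX : IsSmoothManifold X) {f : X → Y} (hf : IsDiffeo f) :
    IsSmoothManifold Y := by
  refine isSmoothManifold_iff.2 ⟨?_, (isSmoothManifold_iff.1 hX).2.of_isDiffeo hf⟩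
  obtain ⟨-, g, hg, -, hr⟩ := hf
  exact @T2Space.mk _ dTopology fun x y hxy =>
    exists_disjoint_isOpen_of_dSmooth hg hX.1 (hr.injective.ne hxy)

theorem of_isContDiffCompatible (V : Type*) [NormedAddCommGroup V] [NormedSpace ℝ V]
    [FiniteDimensional ℝ V] [DiffeologicalSpace V] [IsContDiffCompatible V]
    [IsDTopologyCompatible V] : IsSmoothManifold V := by
  let e := (toEuclidean (E := V)).symm
  have hT2 : @T2Space V dTopology := by
    rw [IsDTopologyCompatible.dTop_eq V]
    infer_instance
  have hchart : IsChart e := by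
    refine ⟨e.contDiff.isPlot, e.injective, ?_, fun n q hq => ?_⟩
    · rw [e.surjective.range_eq]
      exact @isOpen_univ V dTopology
    · simpa [Function.comp_def] using e.symm.contDiff.comp hq.contDiff
  refine isSmoothManifold_iff.2 ⟨hT2, {⟨_, e⟩}, Set.countable_singleton _, ?_, fun x => ?_⟩
  · rintro _ rfl
    exact hchart
  · exact ⟨_, rfl, e.surjective x⟩

theorem of_unique [Unique X] : IsSmoothManifold X :=
  (of_isContDiffCompatible (E 0)).of_isDiffeo (isDiffeo_of_unique fun _ => default)

theorem prod (hX : IsSmoothManifold X) (hY : IsSmoothManifold Y) : IsSmoothManifold (X × Y) := by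
  rw [isSmoothManifold_iff] at hX hY ⊢
  refine ⟨@T2Space.mk _ dTopology fun x y hxy => ?_, hX.2.prod hY.2⟩
  by_cases h : x.1 = y.1
  · exact exists_disjoint_isOpen_of_dSmooth DMap.snd.2 hY.1 fun h' => hxy (Prod.ext h h')
  · exact exists_disjoint_isOpen_of_dSmooth DMap.fst.2 hX.1 h

theorem pi : ∀ {n : ℕ} {X : Fin n → Type*} [∀ i, DiffeologicalSpace (X i)],
    (∀ i, IsSmoothManifold (X i)) → IsSmoothManifold (∀ i, X i)
  | 0, _, _, _ => of_unique
  | _ + 1, X, _, h => ((h 0).prod (pi fun i => h i.succ)).of_isDiffeo (isDiffeo_consEquiv X)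

theorem sigma {ι : Type*} [Countable ι] {X : ι → Type*} [∀ i, DiffeologicalSpace (X i)]
    (hX : ∀ i, IsSmoothManifold (X i)) : IsSmoothManifold (Σ i, X i) := by
  simp only [isSmoothManifold_iff] at hX
  refine isSmoothManifold_iff.2 ⟨@T2Space.mk _ dTopology ?_, .sigma fun i => (hX i).2⟩
  rintro ⟨i, a⟩ ⟨j, b⟩ hxy
  obtain rfl | hij := eq_or_ne i j
  · obtain ⟨r, hr⟩ := exists_dMap_leftInverse_injMap a
    refine exists_disjoint_isOpen_of_dSmooth r.2 (hX i).1 fun h => hxy ?_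
    exact congrArg (Sigma.mk i) ((hr a).symm.trans (h.trans (hr b)))
  · exact exists_disjoint_isOpen_of_dSmooth (dSmooth_indicator_sigma {i})
      (of_isContDiffCompatible ℝ).1 (by simp [hij.symm])

theorem list (hX : IsSmoothManifold X) : IsSmoothManifold (List X) :=
  (sigma fun _ => pi fun _ => hX).of_isDiffeo isDiffeo_equivSigmaTuple.symm

end IsSmoothManifold

end Manifold

/-! ### Tangent bundles -/

section Generated

variable {X Z : Type*} [DiffeologicalSpace Z]

theorem dSmooth_of_generateFrom {g : Set ((n : ℕ) × (E n → X))} {F : X → Z}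
    (h : ∀ p ∈ g, IsPlot (F ∘ p.2)) : @DSmooth X Z (.generateFrom g) _ F := by
  let d : DiffeologicalSpace X :=
    { plots := fun _ => {p | IsPlot (F ∘ p)}
      constant_plots := fun _ => isPlot_const
      plot_reparam := isPlot_reparam
      locality := fun {n p} => DiffeologicalSpace.locality (p := F ∘ p) }
  exact fun n p hp => hp d fun p hp => h p hp

end Generated

namespace Tangent

variable {X Y Z W : Type*} [DiffeologicalSpace X] [DiffeologicalSpace Y] [DiffeologicalSpace Z]
  [DiffeologicalSpace W]

theorem exists_mk (a : Tangent X) : ∃ γ, mk γ = a := Quotient.exists_rep a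

theorem mk_eq_mk {V : Type*} [NormedAddCommGroup V] [NormedSpace ℝ V] [FiniteDimensional ℝ V]
    [DiffeologicalSpace V] [IsContDiffCompatible V] {ψ : V → X} (hψ : DSmooth ψ) {c d : ℝ → V}
    {v : V} (hc : HasDerivAt c v 0) (hd : HasDerivAt d v 0) (h0 : c 0 = d 0) {γ δ : DMap ℝ X}
    (hγ : γ.1 =ᶠ[𝓝 0] ψ ∘ c) (hδ : δ.1 =ᶠ[𝓝 0] ψ ∘ d) : mk γ = mk δ := by
  have hbase : γ 0 = δ 0 :=
    (hγ.eq_of_nhds.trans (congrArg ψ h0)).trans hδ.eq_of_nhds.symm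
  refine Quotient.sound (s := tangentSetoid X) ⟨hbase, fun f => ?_⟩
  have hf : Differentiable ℝ (f.1 ∘ ψ) := (f.2.comp hψ).contDiff.differentiable (by simp)
  calc
    deriv (f.1 ∘ γ.1) 0 = deriv ((f.1 ∘ ψ) ∘ c) 0 := (hγ.fun_comp f.1).deriv_eq
    _ = fderiv ℝ (f.1 ∘ ψ) (c 0) v := ((hf _).hasFDerivAt.comp_hasDerivAt 0 hc).deriv
    _ = fderiv ℝ (f.1 ∘ ψ) (d 0) v := by rw [h0]
    _ = deriv ((f.1 ∘ ψ) ∘ d) 0 := ((hf _).hasFDerivAt.comp_hasDerivAt 0 hd).deriv.symm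
    _ = deriv (f.1 ∘ δ.1) 0 := (hδ.fun_comp f.1).deriv_eq.symm

/- In a chart a smooth family of curves becomes a smooth family of curves `q (w, ·)` in `ℝᵏ`, which
are tangent to the lines through `q (w, 0)` with direction `∂q/∂t (w, 0)`. -/
theorem dSmooth_mk (hX : IsSmoothManifold X) : DSmooth (mk : DMap ℝ X → Tangent X) := by
  intro n p hp
  let F : E n × ℝ → X := fun z => p z.1 z.2
  have hF : DSmooth F := hp
  refine DiffeologicalSpace.locality fun w => ?_
  obtain ⟨k, ψ, hψ, hw⟩ := hX.2.2 (p w 0)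
  let U := F ⁻¹' Set.range ψ
  let q := Function.invFun ψ ∘ F
  have hU : IsOpen U := isOpen_preimage_of_dSmooth hF hψ.2.2.1
  have hq : ∀ z ∈ U, ψ (q z) = F z := fun z hz => Function.invFun_eq hz
  have hqU : ContDiffOn ℝ ∞ q U := hψ.contDiffOn hF hU hq
  refine ⟨(fun w => (w, (0 : ℝ))) ⁻¹' U, hU.preimage (by fun_prop), hw, fun {m h} hhU hh => ?_⟩
  have hh0 : ContDiff ℝ ∞ fun u => (h u, (0 : ℝ)) := hh.prodMk contDiff_const
  have hx : ContDiff ℝ ∞ fun u => q (h u, 0) := hqU.comp_contDiff hh0 hhU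
  have hv : ContDiff ℝ ∞ fun u => fderiv ℝ q (h u, 0) (0, 1) :=
    ((hqU.fderiv_of_isOpen (m := ∞) hU (by simp)).comp_contDiff hh0 hhU).clm_apply contDiff_const
  refine DiffeologicalSpace.isPlot_generatedFrom_of_mem
    ⟨k, ψ, hψ, _, _, hx, hv, funext fun u => ?_⟩
  have hline : HasDerivAt (fun t : ℝ => (h u, t)) (0, 1) 0 :=
    (hasDerivAt_const _ _).prodMk (hasDerivAt_id _)
  have hq0 : HasFDerivAt q (fderiv ℝ q (h u, 0)) (h u, 0) :=
    ((hqU.contDiffAt (hU.mem_nhds (hhU u))).differentiableAt (by simp)).hasFDerivAt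
  have hchart : (p (h u)).1 =ᶠ[𝓝 0] ψ ∘ fun t => q (h u, t) := by
    filter_upwards [(hU.preimage (Continuous.prodMk_right (h u))).mem_nhds (hhU u)] with t ht
    exact (hq _ ht).symm
  refine mk_eq_mk hψ.1.dSmooth (hq0.comp_hasDerivAt 0 hline)
    (d := fun t => q (h u, 0) + t • fderiv ℝ q (h u, 0) (0, 1)) ?_ (by simp) hchart (.of_eq rfl)
  simpa using ((hasDerivAt_id (0 : ℝ)).smul_const (fderiv ℝ q (h u, 0) (0, 1))).const_add
    (q (h u, 0))

theorem dSmooth_of_comp_mk {F : Tangent X → Z} (h : DSmooth (F ∘ mk)) : DSmooth F := by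
  refine dSmooth_of_generateFrom ?_
  rintro ⟨n, p⟩ ⟨k, ψ, hψ, x, v, hx, hv, hp⟩
  rw [hp]
  refine h n (fun w => chartLine ψ hψ.1 (x w) (v w)) ?_
  exact hψ.1.dSmooth.comp (ContDiff.dSmooth (X := E n × ℝ)
    (f := fun z => x z.1 + z.2 • v z.1) (by fun_prop))

theorem dSmooth_of_comp_mk_fst {F : Tangent X × Z → W}
    (h : DSmooth fun z : DMap ℝ X × Z => F (mk z.1, z.2)) : DSmooth F := by
  let G : DMap (DMap ℝ X) (DMap Z W) := .curry ⟨_, h⟩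
  have hslice (a : Tangent X) : DSmooth fun z => F (a, z) := by
    obtain ⟨γ, rfl⟩ := exists_mk a
    exact (G γ).2
  have hcurry : DSmooth (Y := DMap Z W) fun a => ⟨_, hslice a⟩ := dSmooth_of_comp_mk G.2
  exact (DMap.ap (.comp ⟨_, hcurry⟩ .fst) .snd).2

theorem dSmooth_of_comp_mk_mk {F : Tangent X × Tangent Y → W}
    (h : DSmooth fun z : DMap ℝ X × DMap ℝ Y => F (mk z.1, mk z.2)) : DSmooth F := by
  have hsnd : DSmooth fun z : Tangent Y × DMap ℝ X => F (mk z.2, z.1) :=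
    dSmooth_of_comp_mk_fst (h.comp dSmooth_swap)
  exact dSmooth_of_comp_mk_fst (hsnd.comp dSmooth_swap)

theorem map_map (g : DMap Y Z) (f : DMap X Y) (a : Tangent X) :
    map g (map f a) = map (g.comp f) a := by
  obtain ⟨γ, rfl⟩ := exists_mk a
  rfl

theorem map_id (a : Tangent X) : map .id a = a := by
  obtain ⟨γ, rfl⟩ := exists_mk a
  rfl

theorem dSmooth_map (hY : IsSmoothManifold Y) (f : DMap X Y) : DSmooth (map f) :=
  dSmooth_of_comp_mk <| (dSmooth_mk hY).comp fun _ _ hp => f.2.comp hp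

theorem isDiffeo_map (hX : IsSmoothManifold X) {f : DMap X Y} (hf : IsDiffeo f.1) :
    IsDiffeo (map f) := by
  have hY := hX.of_isDiffeo hf
  obtain ⟨-, g, hg, hl, hr⟩ := hf
  let g : DMap Y X := ⟨g, hg⟩
  have hgf : g.comp f = .id := Subtype.ext hl.comp_eq_id
  have hfg : f.comp g = .id := Subtype.ext hr.comp_eq_id
  exact ⟨dSmooth_map hY f, map g, dSmooth_map hX g,
    fun a => by rw [map_map, hgf, map_id], fun a => by rw [map_map, hfg, map_id]⟩

theorem isDiffeo_pair (hX : IsSmoothManifold X) (hY : IsSmoothManifold Y) :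
    IsDiffeo fun z : Tangent X × Tangent Y => pair z.1 z.2 := by
  refine ⟨dSmooth_of_comp_mk_mk <| (dSmooth_mk (hX.prod hY)).comp fun n p hp =>
    (DMap.pair ⟨_, hp.1⟩ ⟨_, hp.2⟩).2, fun a => (map .fst a, map .snd a),
    fun n p hp => ⟨dSmooth_map hX _ n p hp, dSmooth_map hY _ n p hp⟩, ?_, fun a => ?_⟩
  · rintro ⟨a, b⟩
    obtain ⟨γ, rfl⟩ := exists_mk a
    obtain ⟨δ, rfl⟩ := exists_mk b
    rfl
  · obtain ⟨γ, rfl⟩ := exists_mk a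
    rfl

instance [Unique X] : Unique (Tangent X) where
  default := mk (DMap.const default)
  uniq a := by
    obtain ⟨γ, rfl⟩ := exists_mk a
    exact congrArg mk (Subtype.ext (Subsingleton.elim _ _))

theorem tuple_cons {n : ℕ} {X : Fin (n + 1) → Type*} [∀ i, DiffeologicalSpace (X i)]
    (v : ∀ i, Tangent (X i)) :
    tuple v = map (consMap X) (pair (v 0) (tuple fun i => v i.succ)) := by
  choose γ hγ using fun i => exists_mk (v i)
  obtain rfl : (fun i => mk (γ i)) = v := funext hγ
  rw [tuple_mk, tuple_mk]
  exact congrArg mk (Subtype.ext (funext fun t => (Fin.cons_self_tail _).symm))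

theorem isDiffeo_tuple : ∀ {n : ℕ} {X : Fin n → Type*} [∀ i, DiffeologicalSpace (X i)],
    (∀ i, IsSmoothManifold (X i)) → IsDiffeo (tuple (X := X))
  | 0, _, _, _ => isDiffeo_of_unique _
  | n + 1, X, _, h => by
    have hcons := isDiffeo_map ((h 0).prod (.pi fun i => h i.succ)) (f := consMap X)
      (isDiffeo_consEquiv X)
    have htail : IsDiffeo (tuple (X := fun i : Fin n => X i.succ)) :=
      isDiffeo_tuple fun i => h i.succ
    have hid : IsDiffeo (id : Tangent (X 0) → Tangent (X 0)) :=
      ⟨dSmooth_id, id, dSmooth_id, fun _ => rfl, fun _ => rfl⟩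
    rw [show tuple (X := X) = _ from funext tuple_cons]
    exact hcons.comp <| (isDiffeo_pair (h 0) (.pi fun i => h i.succ)).comp <|
      (hid.prodMap htail).comp (isDiffeo_consEquiv fun i => Tangent (X i)).symm

section Sigma

variable {ι : Type*} {X : ι → Type*} [∀ i, DiffeologicalSpace (X i)]

theorem injective_map_injMap :
    Function.Injective fun z : Σ i, Tangent (X i) => map (injMap z.1) z.2 := by
  rintro ⟨i, a⟩ ⟨j, b⟩ h
  obtain ⟨γ, rfl⟩ := exists_mk a
  obtain ⟨δ, rfl⟩ := exists_mk b
  have hbase : injMap i (γ 0) = injMap j (δ 0) :=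
    (Quotient.exact (s := tangentSetoid (Σ i, X i)) h).1
  obtain rfl : i = j := congrArg Sigma.fst hbase
  obtain ⟨r, hr⟩ := exists_dMap_leftInverse_injMap (γ 0)
  have hleft (a : Tangent (X i)) : map r (map (injMap i) a) = a := by
    rw [map_map, show r.comp (injMap i) = .id from Subtype.ext (funext hr), map_id]
  exact congrArg (Sigma.mk i) ((hleft _).symm.trans ((congrArg (map r) h).trans (hleft _)))

theorem isDiffeo_map_injMap [Countable ι] (h : ∀ i, IsSmoothManifold (X i)) :
    IsDiffeo fun z : Σ i, Tangent (X i) => map (injMap z.1) z.2 := by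
  have hsurj : Function.Surjective fun z : Σ i, Tangent (X i) => map (injMap z.1) z.2 := by
    intro a
    obtain ⟨γ, rfl⟩ := exists_mk a
    obtain ⟨i, γ, rfl⟩ := exists_injMap_comp_eq γ
    exact ⟨⟨i, mk γ⟩, rfl⟩
  let e := Equiv.ofBijective _ ⟨injective_map_injMap, hsurj⟩
  refine ⟨?_, e.symm, dSmooth_of_comp_mk fun n p hp => ?_, e.left_inv, e.right_inv⟩
  · rintro n _ ⟨i, q, hq, rfl⟩
    exact dSmooth_map (.sigma h) (injMap i) n q hq
  · obtain ⟨i, g, hg⟩ := exists_injMap_comp_eq (⟨_, hp⟩ : DMap (E n × ℝ) (Σ i, X i))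
    have he : e.symm ∘ mk ∘ p = fun w => ⟨i, mk (g.curry w)⟩ := by
      refine funext fun w => e.symm_apply_eq.2 (congrArg mk (Subtype.ext (funext fun t => ?_)))
      exact (congrFun (congrArg Subtype.val hg) (w, t)).symm
    rw [Function.comp_assoc, he]
    exact ⟨i, _, dSmooth_mk (h i) _ _ g.curry.2.isPlot, rfl⟩

end Sigma

theorem isDiffeo_map_listMap (hX : IsSmoothManifold X) :
    IsDiffeo fun z : Σ k, Fin k → Tangent X => map (listMap z.1) (tuple z.2) := by
  let ofSigma : DMap (Σ k, Fin k → X) (List X) :=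
    ⟨List.equivSigmaTuple.symm, isDiffeo_equivSigmaTuple.symm.1⟩
  have hpow (k : ℕ) : IsSmoothManifold (Fin k → X) := .pi fun _ => hX
  have hof : IsDiffeo (map ofSigma) := isDiffeo_map (.sigma hpow) isDiffeo_equivSigmaTuple.symm
  convert hof.comp <| (isDiffeo_map_injMap hpow).comp <|
    IsDiffeo.sigmaMap fun k => isDiffeo_tuple fun _ : Fin k => hX using 2 with z
  exact (map_map ofSigma (injMap z.1) _).symm

theorem mk_eq_mk_realLine (γ : DMap ℝ ℝ) : mk γ = mk (realLine (γ 0) (deriv γ.1 0)) := by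
  have hγ : HasDerivAt γ.1 (deriv γ.1 0) 0 :=
    (γ.2.contDiff.differentiable (by simp) 0).hasDerivAt
  refine mk_eq_mk dSmooth_id hγ (d := fun t => γ 0 + deriv γ.1 0 * t) ?_ (by simp) (.of_eq rfl)
    (.of_eq rfl)
  simpa using ((hasDerivAt_id (0 : ℝ)).const_mul (deriv γ.1 0)).const_add (γ 0)

/-- The value and the derivative at `0` of a curve in `ℝ`, the coordinates of `Tℝ`. -/
def realCoord : Tangent ℝ → Fin 2 → ℝ :=
  Quotient.lift (s := tangentSetoid ℝ) (fun γ => ![γ 0, deriv γ.1 0]) fun _ _ h => by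
    exact congrArg₂ (![·, ·]) h.1 (h.2 .id)

theorem dSmooth_realCoord : DSmooth realCoord := by
  refine dSmooth_of_comp_mk fun n p hp => Fin.forall_fin_two.2 ?_
  have hF : ContDiff ℝ ∞ fun z : E n × ℝ => p z.1 z.2 := DSmooth.contDiff hp
  exact ⟨(hF.comp (contDiff_id.prodMk contDiff_const)).isPlot,
    ((hF.fderiv contDiff_const (by simp)).clm_apply contDiff_const).isPlot⟩

theorem isDiffeo_mk_realLine : IsDiffeo fun a : Fin 2 → ℝ => mk (realLine (a 0) (a 1)) := by
  refine ⟨?_, realCoord, dSmooth_realCoord, fun a => ?_, fun a => ?_⟩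
  · refine (dSmooth_mk (.of_isContDiffCompatible ℝ)).comp fun n p hp => ?_
    have h0 : ContDiff ℝ ∞ fun w => p w 0 := (hp 0).contDiff
    have h1 : ContDiff ℝ ∞ fun w => p w 1 := (hp 1).contDiff
    exact ContDiff.dSmooth (X := E n × ℝ) (f := fun z => p z.1 0 + p z.1 1 * z.2) (by fun_prop)
  · have hderiv : deriv (fun t => a 0 + a 1 * t) 0 = a 1 := by simp
    exact funext <| Fin.forall_fin_two.2 ⟨show a 0 + a 1 * 0 = a 0 by simp, hderiv⟩
  · obtain ⟨γ, rfl⟩ := exists_mk a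
    exact (mk_eq_mk_realLine γ).symm

end Tangent

/-! ### First order types are manifolds -/

theorem Ty.isSmoothManifold : ∀ {τ : Ty}, τ.FirstOrder → IsSmoothManifold τ.sem
  | .real, _ => .of_isContDiffCompatible ℝ
  | .prod _ _, h => .pi fun i => Ty.isSmoothManifold (h i)
  | .variant _ _, h => .sigma fun i => Ty.isSmoothManifold (h i)
  | .list τ, h => .list (Ty.isSmoothManifold (τ := τ) h)

theorem Ctx.isSmoothManifold : ∀ {Γ : Ctx}, Γ.FirstOrder → IsSmoothManifold Γ.sem
  | .nil, _ => .of_unique (X := Unit)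
  | .snoc _ _, h => .prod (Ctx.isSmoothManifold h.1) (Ty.isSmoothManifold h.2)
  | .block _ _ _, h =>
    .prod (Ctx.isSmoothManifold h.1) (.pi fun i => Ty.isSmoothManifold (h.2 i))

theorem Ty.isDiffeo_toTangent : ∀ {τ : Ty} (h : τ.FirstOrder), IsDiffeo (τ.toTangent h)
  | .real, _ => Tangent.isDiffeo_mk_realLine
  | .prod _ _, h => (Tangent.isDiffeo_tuple fun i => Ty.isSmoothManifold (h i)).comp <|
      .piMap fun i => Ty.isDiffeo_toTangent (h i)
  | .variant _ _, h => (Tangent.isDiffeo_map_injMap fun i => Ty.isSmoothManifold (h i)).comp <|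
      .sigmaMap fun i => Ty.isDiffeo_toTangent (h i)
  | .list τ, h => (Tangent.isDiffeo_map_listMap (Ty.isSmoothManifold (τ := τ) h)).comp <|
      (IsDiffeo.sigmaMap fun _ => .piMap fun _ => Ty.isDiffeo_toTangent (τ := τ) h).comp
        isDiffeo_equivSigmaTuple

theorem Ctx.isDiffeo_toTangent : ∀ {Γ : Ctx} (h : Γ.FirstOrder), IsDiffeo (Γ.toTangent h)
  | .nil, _ => isDiffeo_of_unique (X := Unit) (Y := Tangent Unit) _
  | .snoc _ _, h =>
    (Tangent.isDiffeo_pair (Ctx.isSmoothManifold h.1) (Ty.isSmoothManifold h.2)).comp <|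
      .prodMap (Ctx.isDiffeo_toTangent h.1) (Ty.isDiffeo_toTangent h.2)
  | .block _ _ _, h =>
    have hσ := fun i => Ty.isSmoothManifold (h.2 i)
    (Tangent.isDiffeo_pair (Ctx.isSmoothManifold h.1) (.pi hσ)).comp <|
      .prodMap (Ctx.isDiffeo_toTangent h.1) <|
        (Tangent.isDiffeo_tuple hσ).comp <| .piMap fun i => Ty.isDiffeo_toTangent (h.2 i)

/-! ### Semantics of renamings and of differentiated terms -/

section Semantics

variable {O : Ops.{u}} {Γ Δ : Ctx}

section Renaming

variable {r : Ren Γ Δ} {ρ : Δ.sem} {ρ' : Γ.sem}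

theorem Ren.sem_snoc (h : ∀ τ x, (r τ x).sem ρ = x.sem ρ') (σ : Ty) (a : σ.sem) (τ : Ty)
    (x : Var (Γ.snoc σ) τ) :
    (r.snoc σ τ x).sem ((ρ, a) : (Δ.snoc σ).sem) = x.sem ((ρ', a) : (Γ.snoc σ).sem) := by
  cases x with
  | last => rfl
  | skip x => exact h _ x

theorem Ren.sem_block (h : ∀ τ x, (r τ x).sem ρ = x.sem ρ') (n : ℕ) (σ : Fin n → Ty)
    (a : ∀ i, (σ i).sem) (τ : Ty) (x : Var (Γ.block n σ) τ) :
    (r.block n σ τ x).sem ((ρ, a) : (Δ.block n σ).sem) = x.sem ((ρ', a) : (Γ.block n σ).sem) := by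
  cases x with
  | inBlock i => rfl
  | skipBlock x => exact h _ x

theorem Term.sem_rename {τ : Ty} (t : Term O Γ τ) (h : ∀ τ x, (r τ x).sem ρ = x.sem ρ') :
    (t.rename r).sem ρ = t.sem ρ' := by
  induction t generalizing Δ with
  | var x => exact h _ x
  | const c => rfl
  | add t s iht ihs => exact congrArg₂ (fun a b : ℝ => a + b) (iht h) (ihs h)
  | mul t s iht ihs => exact congrArg₂ (fun a b : ℝ => a * b) (iht h) (ihs h)
  | sigmoid t iht => exact congrArg Real.sigmoid (iht h)
  | op o t iht => exact congrArg (O.interp o) (funext fun i => iht i h)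
  | tuple t iht => exact funext fun i => iht i h
  | split t s iht ihs =>
    exact (ihs (Ren.sem_block h _ _ _)).trans (congrArg (fun a => s.sem (ρ', a)) (iht h))
  | lam t iht => exact Subtype.ext (funext fun a => iht (Ren.sem_snoc h _ a))
  | app t s iht ihs => exact congrArg₂ (fun f a => f.1 a) (iht h) (ihs h)
  | inj i t iht => exact congrArg (Sigma.mk i) (iht h)
  | @cases Γ n σ τ t s iht ihs =>
    have hs (z : Σ i, (σ i).sem) : ((s z.1).rename (r.snoc _)).sem ((ρ, z.2) : (Δ.snoc _).sem) =
        (s z.1).sem ((ρ', z.2) : (Γ.snoc _).sem) := ihs z.1 (Ren.sem_snoc h _ z.2)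
    exact (hs _).trans <|
      congrArg (fun z : Σ i, (σ i).sem => (s z.1).sem (ρ', z.2)) (iht h)
  | nil => rfl
  | cons t s iht ihs => exact congrArg₂ List.cons (iht h) (ihs h)
  | @fold Γ σ τ t s u iht ihs ihu =>
    have ht : (fun a b => (t.rename ((r.snoc τ).snoc σ)).sem ((ρ, a), b)) =
        fun a b => t.sem ((ρ', a), b) :=
      funext₂ fun a b => iht (Ren.sem_snoc (Ren.sem_snoc h _ a) _ b)
    exact (congrArg₂ (List.foldr _) (ihu h) (ihs h)).trans (congrArg (List.foldr · _ _) ht)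

end Renaming

/-- The environment of `pairsCtx Γ k` that extends `ρ` by `xᵢ = a i 0` and `xᵢ' = a i 1`. -/
def pairsEnv (ρ : Γ.sem) : ∀ {k : ℕ}, (Fin k → Fin 2 → ℝ) → (pairsCtx Γ k).sem
  | 0, _ => ρ
  | _ + 1, a => (pairsEnv ρ fun i => a i.castSucc, a (Fin.last _))

theorem pairsVar_last (k : ℕ) (j : Fin 2) :
    pairsVar (Γ := Γ) (Fin.last k) j = .inBlock (σ := fun _ => .real) j :=
  Fin.lastCases_last (motive := fun _ => Var (pairsCtx Γ (k + 1)) .real)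

theorem pairsVar_castSucc {k : ℕ} (i : Fin k) (j : Fin 2) :
    pairsVar (Γ := Γ) i.castSucc j = .skipBlock (pairsVar i j) :=
  Fin.lastCases_castSucc (motive := fun _ => Var (pairsCtx Γ (k + 1)) .real) i

theorem sem_pairsVar (ρ : Γ.sem) : ∀ {k : ℕ} (a : Fin k → Fin 2 → ℝ) (i : Fin k) (j : Fin 2),
    (pairsVar i j).sem (pairsEnv ρ a) = a i j
  | 0, _, i, _ => i.elim0
  | k + 1, a, i, j => by
    cases i using Fin.lastCases with
    | last => exact congrArg (fun x => x.sem (pairsEnv ρ a)) (pairsVar_last k j)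
    | cast i =>
      exact (congrArg (fun x => x.sem (pairsEnv ρ a)) (pairsVar_castSucc i j)).trans
        (sem_pairsVar ρ (fun i => a i.castSucc) i j)

theorem sem_pairsWk (ρ : Γ.sem) : ∀ {k : ℕ} (a : Fin k → Fin 2 → ℝ) (τ : Ty) (x : Var Γ τ),
    (pairsWk k τ x).sem (pairsEnv ρ a) = x.sem ρ
  | 0, _, _, _ => rfl
  | _ + 1, a, τ, x => sem_pairsWk ρ (fun i => a i.castSucc) τ x

theorem sem_splitPairs {τ : Ty} (ρ : Γ.sem) : ∀ {k : ℕ}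
    (t : Fin k → Term O Γ (.prod 2 fun _ => .real)) (s : Term O (pairsCtx Γ k) τ),
    (splitPairs t s).sem ρ = s.sem (pairsEnv ρ fun i => (t i).sem ρ)
  | 0, _, _ => rfl
  | _ + 1, t, s =>
    (sem_splitPairs ρ (fun i => t i.castSucc) _).trans <|
      congrArg (fun a => s.sem (pairsEnv ρ fun i => (t i.castSucc).sem ρ, a)) <|
        Term.sem_rename _ (sem_pairsWk ρ _)

namespace Term

/-- The value of a term of type `real`, typed as a real number so that arithmetic lemmas apply. -/
def eval (t : Term O Γ .real) (ρ : Γ.sem) : ℝ := t.sem ρ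

/-- The value of a term of type `real * real`, typed as a pair of real numbers. -/
def evalPair (t : Term O Γ (.prod 2 fun _ => .real)) (ρ : Γ.sem) : Fin 2 → ℝ := t.sem ρ

section Eval

variable (ρ : Γ.sem)

theorem eval_const (c : ℝ) : (const c : Term O Γ .real).eval ρ = c := rfl

theorem eval_add (t s : Term O Γ .real) : (t.add s).eval ρ = t.eval ρ + s.eval ρ := rfl

theorem eval_mul (t s : Term O Γ .real) : (t.mul s).eval ρ = t.eval ρ * s.eval ρ := rfl

theorem eval_sub (t s : Term O Γ .real) : (t.sub s).eval ρ = t.eval ρ - s.eval ρ := by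
  simp only [sub, eval_add, eval_mul, eval_const, neg_one_mul, sub_eq_add_neg]

theorem eval_op {n : ℕ} (o : O.Op n) (t : Fin n → Term O Γ .real) :
    (op o t).eval ρ = O.interp o (fun i => (t i).eval ρ) := rfl

theorem eval_sum : ∀ {n : ℕ} (t : Fin n → Term O Γ .real), (sum t).eval ρ = ∑ i, (t i).eval ρ
  | 0, _ => rfl
  | n + 1, t => by
    rw [Fin.sum_univ_succ, ← eval_sum fun i => t i.succ]
    rfl

theorem eval_pairsVar {k : ℕ} (a : Fin k → Fin 2 → ℝ) (i : Fin k) (j : Fin 2) :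
    (var (O := O) (pairsVar i j)).eval (pairsEnv ρ a) = a i j := sem_pairsVar ρ a i j

theorem eval_rename_pairsRen {n : ℕ} (t : Term O (realCtx n) .real) (a : Fin n → Fin 2 → ℝ) :
    (t.rename pairsRen).eval (pairsEnv ρ a) = t.eval ((), fun i => a i 0) := by
  refine sem_rename t fun τ x => ?_
  cases x with
  | inBlock i => exact sem_pairsVar ρ a i 0
  | skipBlock x => exact nomatch x

theorem evalPair_dual (t s : Term O Γ .real) : (t.dual s).evalPair ρ = ![t.eval ρ, s.eval ρ] :=
  funext (Fin.forall_fin_two.2 ⟨rfl, rfl⟩)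

theorem evalPair_letIn (t : Term O Γ .real) (s : Term O (Γ.snoc .real) (.prod 2 fun _ => .real)) :
    (t.letIn s).evalPair ρ = s.evalPair ((ρ, t.eval ρ) : (Γ.snoc .real).sem) := rfl

theorem evalPair_splitPairs {k : ℕ} (t : Fin k → Term O Γ (.prod 2 fun _ => .real))
    (s : Term O (pairsCtx Γ k) (.prod 2 fun _ => .real)) :
    (splitPairs t s).evalPair ρ = s.evalPair (pairsEnv ρ fun i => (t i).evalPair ρ) :=
  sem_splitPairs ρ t s

end Eval

variable (pd : Partials O) (ρ : Γ.D.sem)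

theorem evalPair_D_add (t s : Term O Γ .real) :
    ((t.add s).D pd).evalPair ρ =
      ![(t.D pd).evalPair ρ 0 + (s.D pd).evalPair ρ 0,
        (t.D pd).evalPair ρ 1 + (s.D pd).evalPair ρ 1] := by
  refine (evalPair_splitPairs _ _ _).trans ((evalPair_dual _ _ _).trans ?_)
  simp only [eval_add, eval_pairsVar]
  rfl

theorem evalPair_D_mul (t s : Term O Γ .real) :
    ((t.mul s).D pd).evalPair ρ =
      ![(t.D pd).evalPair ρ 0 * (s.D pd).evalPair ρ 0,
        (t.D pd).evalPair ρ 0 * (s.D pd).evalPair ρ 1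
          + (t.D pd).evalPair ρ 1 * (s.D pd).evalPair ρ 0] := by
  refine (evalPair_splitPairs _ _ _).trans ((evalPair_dual _ _ _).trans ?_)
  simp only [eval_add, eval_mul, eval_pairsVar]
  rfl

theorem evalPair_D_sigmoid (t : Term O Γ .real) :
    (t.sigmoid.D pd).evalPair ρ =
      ![Real.sigmoid ((t.D pd).evalPair ρ 0),
        (t.D pd).evalPair ρ 1 * Real.sigmoid ((t.D pd).evalPair ρ 0)
          * (1 - Real.sigmoid ((t.D pd).evalPair ρ 0))] := by
  have hderiv {Δ : Ctx} (x' z : Term O Δ .real) (ρ : Δ.sem) :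
      ((x'.mul z).mul ((const 1).sub z)).eval ρ = x'.eval ρ * z.eval ρ * (1 - z.eval ρ) := by
    simp only [eval_mul, eval_sub, eval_const]
  have hx (j : Fin 2) := eval_pairsVar (O := O) ρ (fun _ : Fin 1 => (t.D pd).evalPair ρ) 0 j
  have hz := congrArg Real.sigmoid (hx 0)
  refine (evalPair_splitPairs _ _ _).trans <| (evalPair_letIn _ _ _).trans <|
    (evalPair_dual _ _ _).trans ?_
  exact congrArg₂ (fun u v : ℝ => ![u, v]) hz <|
    (hderiv _ _ _).trans (congrArg₂ (fun u v : ℝ => u * v * (1 - v)) (hx 1) hz)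

theorem evalPair_D_op {n : ℕ} (o : O.Op n) (t : Fin n → Term O Γ .real) :
    ((op o t).D pd).evalPair ρ =
      ![O.interp o fun i => ((t i).D pd).evalPair ρ 0,
        ∑ i, ((t i).D pd).evalPair ρ 1 *
          (pd n o i).eval ((), fun i => ((t i).D pd).evalPair ρ 0)] := by
  refine (evalPair_splitPairs _ _ _).trans ((evalPair_dual _ _ _).trans ?_)
  simp only [eval_op, eval_sum, eval_mul, eval_pairsVar, eval_rename_pairsRen]

end Term

end Semantics

/-! ### The logical relation -/

theorem hasDerivAt_comp_partials {n : ℕ} {F : (Fin n → ℝ) → ℝ} {f : Fin n → ℝ → ℝ}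
    {f' : Fin n → ℝ} {t : ℝ} (hF : DifferentiableAt ℝ F fun i => f i t)
    (hf : ∀ i, HasDerivAt (f i) (f' i) t) :
    HasDerivAt (fun t => F fun i => f i t)
      (∑ i, f' i * deriv (fun s => F (Function.update (fun i => f i t) i s)) (f i t)) t := by
  set x : Fin n → ℝ := fun i => f i t
  have hx : HasFDerivAt F (fderiv ℝ F x) x := hF.hasFDerivAt
  have hpartial (i : Fin n) :
      deriv (fun s => F (Function.update x i s)) (x i) = fderiv ℝ F x (Pi.single i 1) := by
    have hx' : HasFDerivAt F (fderiv ℝ F x) (Function.update x i (x i)) := by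
      rwa [Function.update_eq_self]
    exact (hx'.comp_hasDerivAt (x i) (hasDerivAt_update x i (x i))).deriv
  have hsum : fderiv ℝ F x f' = ∑ i, f' i * fderiv ℝ F x (Pi.single i 1) := by
    conv_lhs => rw [pi_eq_sum_univ' f', map_sum]
    simp only [map_smul, smul_eq_mul]
  refine (hx.comp_hasDerivAt t (hasDerivAt_pi.2 hf)).congr_deriv (hsum.trans ?_)
  exact Finset.sum_congr rfl fun i _ => congrArg (f' i * ·) (hpartial i).symm

/-- The logical relation at the type of reals: `f` is smooth and `g` is the curve `(f, f')` of its
values and derivatives. -/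
def IsDual (f : ℝ → ℝ) (g : ℝ → Fin 2 → ℝ) : Prop :=
  ContDiff ℝ ∞ f ∧ ∀ t, g t = ![f t, deriv f t]

namespace IsDual

variable {f f₁ f₂ : ℝ → ℝ} {g g' g₁ g₂ : ℝ → Fin 2 → ℝ}

theorem of_hasDerivAt {f' : ℝ → ℝ} (hf : ContDiff ℝ ∞ f) (hf' : ∀ t, HasDerivAt f (f' t) t)
    (hg : ∀ t, g t = ![f t, f' t]) : IsDual f g :=
  ⟨hf, fun t => by rw [hg, (hf' t).deriv]⟩

theorem congr_right (h : IsDual f g) (hg : ∀ t, g' t = g t) : IsDual f g' :=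
  ⟨h.1, fun t => (hg t).trans (h.2 t)⟩

theorem hasDerivAt (h : IsDual f g) (t : ℝ) : HasDerivAt f (g t 1) t := by
  rw [h.2]
  exact (h.1.differentiable (by simp) t).hasDerivAt

theorem eq_apply_zero (h : IsDual f g) (t : ℝ) : f t = g t 0 := by
  rw [h.2]
  rfl

theorem const (c : ℝ) : IsDual (fun _ => c) fun _ => ![c, 0] :=
  of_hasDerivAt contDiff_const (fun _ => hasDerivAt_const _ c) fun _ => rfl

theorem line (a b : ℝ) : IsDual (fun t => a + b * t) fun t => ![a + b * t, b] :=
  of_hasDerivAt (by fun_prop)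
    (fun t => by simpa using ((hasDerivAt_id t).const_mul b).const_add a) fun _ => rfl

theorem add (h₁ : IsDual f₁ g₁) (h₂ : IsDual f₂ g₂) :
    IsDual (fun t => f₁ t + f₂ t) fun t => ![g₁ t 0 + g₂ t 0, g₁ t 1 + g₂ t 1] :=
  of_hasDerivAt (h₁.1.add h₂.1) (fun t => (h₁.hasDerivAt t).add (h₂.hasDerivAt t)) fun t => by
    rw [h₁.eq_apply_zero, h₂.eq_apply_zero]

theorem mul (h₁ : IsDual f₁ g₁) (h₂ : IsDual f₂ g₂) :
    IsDual (fun t => f₁ t * f₂ t)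
      fun t => ![g₁ t 0 * g₂ t 0, g₁ t 0 * g₂ t 1 + g₁ t 1 * g₂ t 0] :=
  of_hasDerivAt (h₁.1.mul h₂.1) (fun t => (h₁.hasDerivAt t).mul (h₂.hasDerivAt t)) fun t => by
    rw [h₁.eq_apply_zero, h₂.eq_apply_zero, add_comm]

theorem sigmoid (h : IsDual f g) :
    IsDual (fun t => Real.sigmoid (f t)) fun t =>
      ![Real.sigmoid (g t 0), g t 1 * Real.sigmoid (g t 0) * (1 - Real.sigmoid (g t 0))] :=
  of_hasDerivAt ((contDiff_sigmoid.of_le le_top).comp h.1)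
    (fun t => (Real.hasDerivAt_sigmoid _).comp t (h.hasDerivAt t)) fun t => by
      rw [h.eq_apply_zero, mul_assoc, mul_comm]

theorem comp {n : ℕ} {F : (Fin n → ℝ) → ℝ} (hF : ContDiff ℝ ∞ F) {f : Fin n → ℝ → ℝ}
    {g : Fin n → ℝ → Fin 2 → ℝ} (h : ∀ i, IsDual (f i) (g i)) :
    IsDual (fun t => F fun i => f i t) fun t => ![F fun i => g i t 0, ∑ i, g i t 1 *
      deriv (fun s => F (Function.update (fun i => g i t 0) i s)) (g i t 0)] :=
  of_hasDerivAt (hF.comp (contDiff_pi.2 fun i => (h i).1))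
    (fun t => hasDerivAt_comp_partials (hF.differentiable (by simp) _)
      fun i => (h i).hasDerivAt t) fun t => by
      simp only [(h _).eq_apply_zero]

theorem mk_realLine_eq (h : IsDual f g) :
    Tangent.mk (realLine (g 0 0) (g 0 1)) = Tangent.mk ⟨f, h.1.dSmooth⟩ := by
  rw [h.2]
  exact (Tangent.mk_eq_mk_realLine ⟨f, h.1.dSmooth⟩).symm

end IsDual

/-- The logical relation between curves in `⟦τ⟧` and in `⟦D τ⟧`: at the type of reals the second
curve consists of the values and derivatives of the first, and this is lifted along the type
constructors. Curves in variants stay in one summand and curves of lists have constant length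
because `ℝ` is connected. -/
def Ty.Rel : ∀ τ : Ty, (ℝ → τ.sem) → (ℝ → τ.D.sem) → Prop
  | .real, f, g => IsDual f g
  | .prod _ σ, f, g => ∀ i, (σ i).Rel (fun t => f t i) (fun t => g t i)
  | .fn σ τ, f, g => ∀ a b, σ.Rel a b →
      τ.Rel (fun t => (f t).1 (a t)) (fun t => (g t).1 (b t))
  | .variant _ σ, f, g => ∃ i a b, (σ i).Rel a b ∧
      (f = fun t => ⟨i, a t⟩) ∧ (g = fun t => ⟨i, b t⟩)
  | .list τ, f, g => ∃ (k : ℕ) (a : Fin k → ℝ → τ.sem) (b : Fin k → ℝ → τ.D.sem),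
      (∀ i, τ.Rel (a i) (b i)) ∧
      (f = fun t => List.ofFn fun i => a i t) ∧ (g = fun t => List.ofFn fun i => b i t)

/-- The logical relation between curves in `⟦Γ⟧` and in `⟦D Γ⟧`: the logical relation at the type
of each variable. -/
def Ctx.Rel (Γ : Ctx) (f : ℝ → Γ.sem) (g : ℝ → Γ.D.sem) : Prop :=
  ∀ (τ : Ty) (x : Var Γ τ), τ.Rel (fun t => x.sem (f t)) (fun t => x.D.sem (g t))

section ContextRel

variable {Γ : Ctx} {f : ℝ → Γ.sem} {g : ℝ → Γ.D.sem}

theorem Ctx.Rel.snoc (h : Γ.Rel f g) {σ : Ty} {a : ℝ → σ.sem} {b : ℝ → σ.D.sem}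
    (hab : σ.Rel a b) : (Γ.snoc σ).Rel (fun t => (f t, a t)) (fun t => (g t, b t)) := by
  intro τ x
  cases x with
  | last => exact hab
  | skip x => exact h _ x

theorem Ctx.Rel.block (h : Γ.Rel f g) {n : ℕ} {σ : Fin n → Ty} {a : ∀ i, ℝ → (σ i).sem}
    {b : ∀ i, ℝ → (σ i).D.sem} (hab : ∀ i, (σ i).Rel (a i) (b i)) :
    (Γ.block n σ).Rel (fun t => (f t, fun i => a i t)) (fun t => (g t, fun i => b i t)) := by
  intro τ x
  cases x with
  | inBlock i => exact hab i
  | skipBlock x => exact h _ x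

end ContextRel

namespace Ty.Rel

variable {σ τ : Ty}

theorem variant_elim {n : ℕ} {σ : Fin n → Ty} {F : ℝ → (Ty.variant n σ).sem → τ.sem}
    {G : ℝ → (Ty.variant n σ).D.sem → τ.D.sem}
    (hFG : ∀ i a b, (σ i).Rel a b → τ.Rel (fun t => F t ⟨i, a t⟩) (fun t => G t ⟨i, b t⟩))
    {f : ℝ → (Ty.variant n σ).sem} {g : ℝ → (Ty.variant n σ).D.sem}
    (h : (Ty.variant n σ).Rel f g) : τ.Rel (fun t => F t (f t)) (fun t => G t (g t)) := by
  obtain ⟨i, a, b, hab, rfl, rfl⟩ := h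
  exact hFG i a b hab

theorem list_nil : (Ty.list τ).Rel (fun _ => []) (fun _ => []) :=
  ⟨0, Fin.elim0, Fin.elim0, fun i => i.elim0, rfl, rfl⟩

theorem list_cons {a : ℝ → τ.sem} {b : ℝ → τ.D.sem} (hab : τ.Rel a b) {f : ℝ → List τ.sem}
    {g : ℝ → List τ.D.sem} (h : (Ty.list τ).Rel f g) :
    (Ty.list τ).Rel (fun t => a t :: f t) (fun t => b t :: g t) := by
  obtain ⟨k, as, bs, habs, rfl, rfl⟩ := h
  have hcons {X : Type} (x : ℝ → X) (xs : Fin k → ℝ → X) :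
      (fun t => x t :: List.ofFn fun i => xs i t) =
        fun t => List.ofFn fun i => (Fin.cons x xs : Fin (k + 1) → ℝ → X) i t := by
    simp only [List.ofFn_succ, Fin.cons_zero, Fin.cons_succ]
  exact ⟨k + 1, Fin.cons a as, Fin.cons b bs, Fin.cases hab habs, hcons a as, hcons b bs⟩

theorem list_foldr {F : ℝ → τ.sem → σ.sem → σ.sem} {G : ℝ → τ.D.sem → σ.D.sem → σ.D.sem}
    (hFG : ∀ a b c d, τ.Rel a b → σ.Rel c d →
      σ.Rel (fun t => F t (a t) (c t)) (fun t => G t (b t) (d t)))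
    {c : ℝ → σ.sem} {d : ℝ → σ.D.sem} (hcd : σ.Rel c d) {f : ℝ → List τ.sem}
    {g : ℝ → List τ.D.sem} (h : (Ty.list τ).Rel f g) :
    σ.Rel (fun t => (f t).foldr (F t) (c t)) (fun t => (g t).foldr (G t) (d t)) := by
  obtain ⟨k, a, b, hab, rfl, rfl⟩ := h
  induction k with
  | zero => exact hcd
  | succ k ih =>
    simp only [List.ofFn_succ, List.foldr_cons]
    exact hFG _ _ _ _ (hab 0) (ih _ _ fun i => hab i.succ)

end Ty.Rel

theorem Term.rel_sem {O : Ops.{u}} {pd : Partials O} (hpd : pd.Correct) {Γ : Ctx} {τ : Ty}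
    (t : Term O Γ τ) {f : ℝ → Γ.sem} {g : ℝ → Γ.D.sem} (h : Γ.Rel f g) :
    τ.Rel (fun x => t.sem (f x)) (fun x => (t.D pd).sem (g x)) := by
  induction t with
  | var x => exact h _ x
  | const c => exact (IsDual.const c).congr_right fun x => evalPair_dual _ _ _
  | add t s iht ihs =>
    exact (IsDual.add (iht h) (ihs h)).congr_right fun x => evalPair_D_add pd (g x) t s
  | mul t s iht ihs =>
    exact (IsDual.mul (iht h) (ihs h)).congr_right fun x => evalPair_D_mul pd (g x) t s
  | sigmoid t iht =>
    exact (IsDual.sigmoid (iht h)).congr_right fun x => evalPair_D_sigmoid pd (g x) t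
  | op o t iht =>
    refine (IsDual.comp (O.smooth o) fun i => iht i h).congr_right fun x =>
      (evalPair_D_op pd (g x) o t).trans (congrArg (![_, ·]) ?_)
    exact Finset.sum_congr rfl fun i _ => congrArg _ (hpd _ o i _)
  | tuple _ iht => exact fun i => iht i h
  | split _ _ iht ihs => exact ihs (h.block (iht h))
  | lam _ iht => exact fun a b hab => iht (h.snoc hab)
  | app _ _ iht ihs => exact iht h _ _ (ihs h)
  | inj i _ iht => exact ⟨i, _, _, iht h, rfl, rfl⟩
  | cases t s iht ihs =>
    exact Ty.Rel.variant_elim (F := fun x z => (s z.1).sem (f x, z.2))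
      (G := fun x z => ((s z.1).D pd).sem (g x, z.2)) (fun i a b hab => ihs i (h.snoc hab)) (iht h)
  | nil => exact Ty.Rel.list_nil
  | cons _ _ iht ihs => exact Ty.Rel.list_cons (iht h) (ihs h)
  | fold t s r iht ihs ihr =>
    exact Ty.Rel.list_foldr (F := fun x y z => t.sem ((f x, y), z))
      (G := fun x y z => (t.D pd).sem ((g x, y), z))
      (fun a b c d hab hcd => iht ((h.snoc hab).snoc hcd)) (ihr h) (ihs h)

/-! ### Related curves and tangent vectors -/

theorem Ty.toTangent_ofFn {τ : Ty} (hτ : τ.FirstOrder) {k : ℕ} (a : Fin k → τ.D.sem) :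
    Ty.toTangent (.list τ) hτ (List.ofFn a) =
      Tangent.map (listMap k) (Tangent.tuple fun i => τ.toTangent hτ (a i)) :=
  congrArg (fun z : Σ k, Fin k → τ.D.sem =>
    Tangent.map (listMap z.1) (Tangent.tuple fun i => τ.toTangent hτ (z.2 i)))
    (List.equivSigmaTuple.apply_symm_apply ⟨k, a⟩)

theorem Ty.Rel.toTangent : ∀ {τ : Ty} (hτ : τ.FirstOrder) {f : ℝ → τ.sem} {g : ℝ → τ.D.sem},
    τ.Rel f g → ∃ hf : DSmooth f, τ.toTangent hτ (g 0) = Tangent.mk ⟨f, hf⟩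
  | .real, _, f, g, h => ⟨h.1.dSmooth, IsDual.mk_realLine_eq h⟩
  | .prod n σ, hτ, f, g, h => by
    choose hf e using fun i => (h i).toTangent (hτ i)
    exact ⟨fun n p hp i => hf i n p hp,
      (congrArg Tangent.tuple (funext e)).trans (Tangent.tuple_mk _)⟩
  | .variant n σ, hτ, _, _, ⟨i, a, b, hab, rfl, rfl⟩ => by
    obtain ⟨hf, e⟩ := hab.toTangent (hτ i)
    let inj : DMap (σ i).sem (Ty.variant n σ).sem := injMap (X := fun i => (σ i).sem) i
    exact ⟨inj.2.comp hf, congrArg (Tangent.map inj) e⟩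
  | .list τ, hτ, _, _, ⟨k, a, b, hab, rfl, rfl⟩ => by
    choose hf e using fun i => (hab i).toTangent (τ := τ) hτ
    have he := (congrArg Tangent.tuple (funext e)).trans (Tangent.tuple_mk _)
    exact ⟨(listMap k).2.comp (f := fun t i => a i t) fun n p hp i => hf i n p hp,
      (Ty.toTangent_ofFn (τ := τ) hτ _).trans (congrArg (Tangent.map (listMap k)) he)⟩

theorem Ctx.Rel.toTangent : ∀ {Γ : Ctx} (hΓ : Γ.FirstOrder) {f : ℝ → Γ.sem} {g : ℝ → Γ.D.sem},
    Γ.Rel f g → ∃ hf : DSmooth f, Γ.toTangent hΓ (g 0) = Tangent.mk ⟨f, hf⟩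
  | .nil, _, _, _, _ => ⟨fun _ _ _ => trivial, rfl⟩
  | .snoc Γ τ, hΓ, f, g, h => by
    obtain ⟨hf, e⟩ := Ctx.Rel.toTangent (Γ := Γ) (f := fun t => (f t).1) (g := fun t => (g t).1)
      hΓ.1 fun _ x => h _ x.skip
    obtain ⟨hf', e'⟩ := Ty.Rel.toTangent (τ := τ) hΓ.2 (h _ .last)
    exact ⟨fun n p hp => ⟨hf n p hp, hf' n p hp⟩, congrArg₂ Tangent.pair e e'⟩
  | .block Γ n σ, hΓ, f, g, h => by
    obtain ⟨hf, e⟩ := Ctx.Rel.toTangent (Γ := Γ) (f := fun t => (f t).1) (g := fun t => (g t).1)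
      hΓ.1 fun _ x => h _ x.skipBlock
    choose hf' e' using fun i => Ty.Rel.toTangent (hΓ.2 i) (h _ (.inBlock i))
    exact ⟨fun n p hp => ⟨hf n p hp, fun i => hf' i n p hp⟩,
      congrArg₂ Tangent.pair e ((congrArg Tangent.tuple (funext e')).trans (Tangent.tuple_mk _))⟩

theorem Ty.exists_rel : ∀ {τ : Ty}, τ.FirstOrder → ∀ a : τ.D.sem,
    ∃ (f : ℝ → τ.sem) (g : ℝ → τ.D.sem), τ.Rel f g ∧ g 0 = a
  | .real, _, (a : Fin 2 → ℝ) => by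
    have hline : ![a 0 + a 1 * 0, a 1] = a := by
      rw [mul_zero, add_zero]
      exact funext (Fin.forall_fin_two.2 ⟨rfl, rfl⟩)
    exact ⟨_, _, IsDual.line (a 0) (a 1), hline⟩
  | .prod n σ, hτ, a => by
    choose f g h e using fun i => Ty.exists_rel (hτ i) (a i)
    exact ⟨fun t i => f i t, fun t i => g i t, h, funext e⟩
  | .variant n σ, hτ, ⟨i, a⟩ => by
    obtain ⟨f, g, h, rfl⟩ := Ty.exists_rel (hτ i) a
    exact ⟨_, _, ⟨i, f, g, h, rfl, rfl⟩, rfl⟩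
  | .list τ, hτ, a => by
    choose f g h e using fun i => Ty.exists_rel (τ := τ) hτ (List.get a i)
    refine ⟨_, _, ⟨List.length a, f, g, h, rfl, rfl⟩, ?_⟩
    simp only [e]
    exact List.ofFn_get a

theorem Ctx.exists_rel : ∀ {Γ : Ctx}, Γ.FirstOrder → ∀ ρ : Γ.D.sem,
    ∃ (f : ℝ → Γ.sem) (g : ℝ → Γ.D.sem), Γ.Rel f g ∧ g 0 = ρ
  | .nil, _, _ => ⟨fun _ => (), fun _ => (), (fun _ x => nomatch x), rfl⟩
  | .snoc Γ τ, hΓ, ρ => by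
    obtain ⟨f, g, h, e⟩ := Ctx.exists_rel hΓ.1 ρ.1
    obtain ⟨f', g', h', e'⟩ := Ty.exists_rel hΓ.2 ρ.2
    exact ⟨_, _, h.snoc h', Prod.ext e e'⟩
  | .block Γ n σ, hΓ, ρ => by
    obtain ⟨f, g, h, e⟩ := Ctx.exists_rel hΓ.1 ρ.1
    choose f' g' h' e' using fun i => Ty.exists_rel (hΓ.2 i) (ρ.2 i)
    exact ⟨_, _, h.block h', Prod.ext e (funext e')⟩

end AD

end

theorem theorem2 (O : Ops) (pd : Partials O) (hpd : pd.Correct)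
    (Γ : Ctx) (hΓ : Γ.FirstOrder) (τ : Ty) (hτ : τ.FirstOrder) (t : Term O Γ τ) :
    IsSmoothManifold Γ.sem ∧ IsSmoothManifold τ.sem ∧
      IsDiffeo (Γ.toTangent hΓ) ∧ IsDiffeo (τ.toTangent hτ) ∧
      ∀ ρ : Γ.D.sem,
        τ.toTangent hτ ((t.D pd).sem ρ) = Tangent.map t.sem (Γ.toTangent hΓ ρ) := by
  refine ⟨Ctx.isSmoothManifold hΓ, Ty.isSmoothManifold hτ,
    Ctx.isDiffeo_toTangent hΓ, Ty.isDiffeo_toTangent hτ, fun ρ => ?_⟩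
  obtain ⟨f, g, hfg, rfl⟩ := Ctx.exists_rel hΓ ρ
  obtain ⟨hf, hΓfg⟩ := hfg.toTangent hΓ
  obtain ⟨htf, hτfg⟩ := (t.rel_sem hpd hfg).toTangent hτ
  exact hτfg.trans (congrArg (Tangent.map t.sem) hΓfg).symm
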